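/- Theorem 1.1 ("Log-concave Bernstein theorem"). Let $\varphi:[0,\infty)\to\mathbb R$ be continuous on $[0,\infty)$ and $C^\infty$-smooth on $(0,\infty)$. For $t>0$ and integers $n\ge 0$ put $$a_t(n)=(-1)^n\,\frac{\varphi^{(n)}(t)}{n!}.$$ Then the following are equivalent. (i) For every $t>0$ the sequence $(a_t(n))_{n\ge 0}$ is log-concave, that is, $a_t(n)\ge 0$ for all $n\ge 0$, and for all integers $m,n\ge 0$ and all $\lambda\in(0,1)$ such that $\lambda n+(1-\lambda)m$ is an integer, $$a_t(\lambda n+(1-\lambda)m)\ \ge\ a_t(n)^{\lambda}\,a_t(m)^{1-\lambda}.$$ (ii) There is a finite log-concave Borel measure $\mu$ on $[0,\infty)$ such that $$\varphi(t)=\int_{[0,\infty)}e^{-tx}\,d\mu(x)\qquad\text{for all } t\ge 0.$$ Here a measure $\mu$ on $[0,\infty)$ is called log-concave if either $\mu=c\,\delta_{x_0}$ for some real $c\ge 0$ and some $x_0\ge 0$, or $\mu$ is absolutely continuous with respect to Lebesgue measure on $[0,\infty)$ with a density $f:[0,\infty)\to\mathbb R$ that is log-concave, that is, $f\ge 0$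 and $$f(\lambda x+(1-\lambda)y)\ \ge\ f(x)^{\lambda}f(y)^{1-\lambda}\qquad\text{for all } x,y\ge 0,\ 0<\lambda<1.$$ -/

import Mathlib

open MeasureTheory Set
open scoped ContDiff NNReal

/-- A sequence of real numbers is log-concave if its terms are non-negative and
`a (l * n + (1 - l) * m) ≥ a n ^ l * a m ^ (1 - l)` for all indices `m`, `n` and all `l ∈ (0, 1)`
for which `l * n + (1 - l) * m` is an integer `k` (necessarily `k ≥ 0`). -/
def IsLogConcaveSeq (a : ℕ → ℝ) : Prop :=
  (∀ n, 0 ≤ a n) ∧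
    ∀ (m n k : ℕ) (l : ℝ), 0 < l → l < 1 → l * (n : ℝ) + (1 - l) * (m : ℝ) = (k : ℝ) →
      a n ^ l * a m ^ (1 - l) ≤ a k

/-- A real function is log-concave on a convex set `K` of a real vector space if it is
non-negative on `K` and `f (l x + (1 - l) y) ≥ f x ^ l * f y ^ (1 - l)` for all `x, y ∈ K` and
`0 < l < 1`. -/
def IsLogConcaveOn {E : Type*} [AddCommGroup E] [Module ℝ E] (K : Set E) (f : E → ℝ) : Prop :=
  Convex ℝ K ∧ (∀ x ∈ K, 0 ≤ f x) ∧
    ∀ x ∈ K, ∀ y ∈ K, ∀ l : ℝ, 0 < l → l < 1 →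
      f x ^ l * f y ^ (1 - l) ≤ f (l • x + (1 - l) • y)

/-- The alternating Taylor coefficients `(-1)^n φ^{(n)}(t) / n!`; for `t > 0` they only depend on
the values of `φ` near `t`. -/
noncomputable def altTaylorCoeff (φ : ℝ → ℝ) (t : ℝ) (n : ℕ) : ℝ :=
  (-1) ^ n * iteratedDeriv n φ t / (n.factorial : ℝ)

/-- A log-concave measure on the half-line `[0, ∞)`, seen as a Borel measure on `ℝ` that is
concentrated on `[0, ∞)`: either a non-negative multiple of a Dirac mass at a point of `[0, ∞)`,
or a measure which has, with respect to Lebesgue measure on `[0, ∞)`, a density that is a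
log-concave function on `[0, ∞)`. Such a density is automatically measurable on `[0, ∞)`. -/
def IsLogConcaveMeasureOnHalfLine (μ : Measure ℝ) : Prop :=
  (∃ (c : ℝ≥0) (x₀ : ℝ), 0 ≤ x₀ ∧ μ = c • Measure.dirac x₀) ∨
    ∃ f : ℝ → ℝ, IsLogConcaveOn (Ici (0 : ℝ)) f ∧
      μ = (volume.restrict (Ici (0 : ℝ))).withDensity (fun x => ENNReal.ofReal (f x))

/-! (i) ⇒ (ii). Write `a_t(n)` for `altTaylorCoeff φ t n`. The signs of the derivatives force the
Taylor series at `t` to converge on `(0, t]` (`hasSum_altTaylorCoeff`). Evaluated at `s = t (1 -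
e^{-u/t})` it reads `φ(s) = ∑ t^n a_t(n) e^{-u n/t}`: the Laplace transform at `u` of the measure
with weights `t^n a_t(n)` at the lattice points `n/t`. The weights form a log-concave sequence, and
so do their sums over windows of fixed length (`sum_window`); hence the masses of intervals of equal
length are log-concave up to an error of the order of the mesh `1/t`
(`expLatticeMeasure_rpow_mul_le`). As `t → ∞`, `s → u`, and the total masses stay below `φ(0)`, so a
limit measure exists, represents `φ`, and is log-concave on intervals. The one-dimensional Borell
theorem (`LogConcaveOnBalls.isLogConcaveMeasureOnHalfLine`) then gives a Dirac mass or a log-concave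
density. For compactness the limit is taken on `[0, 1]` in the variable `y = e^{-x}`, where
`e^{-ux}` becomes `y^u`; mass escaping to `x = ∞` sits at `y = 0`, where `y^u` vanishes.

(ii) ⇒ (i). The coefficients are the moments of `e^{-tx} dμ` divided by `n!`
(`altTaylorCoeff_laplace`). For a density, compare with `α e^{-βx}`, whose normalized moments are
geometric, chosen to have the same moments of orders `n` and `n + 2`. By log-concavity the
difference is positive exactly on an interval, and a sign argument
(`integral_pow_mul_nonneg_of_ordConnected`) shows that its moment of order `n + 1` is nonnegative. A
Dirac mass gives `C x^n / n!`. -/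

/-! ### Pólya frequency sequences of order two. -/

/-- A nonnegative sequence indexed by `ℤ` is a Pólya frequency sequence of order two if
`w (p - 1) * w (q + 1) ≤ w p * w q` for `p ≤ q`. Equivalently, it is log-concave and its support
has no gaps. -/
structure IsPolyaFreqSeq (w : ℤ → ℝ) : Prop where
  nonneg : ∀ n, 0 ≤ w n
  mul_le : ∀ p q, p ≤ q → w (p - 1) * w (q + 1) ≤ w p * w q

namespace IsPolyaFreqSeq

variable {w : ℤ → ℝ}

/-- Iterating the defining inequality moves both outer indices inward, one step at a time, with
constant sum. -/
theorem mul_le_mul_of_le (hw : IsPolyaFreqSeq w) {a b c d : ℤ} (hab : a ≤ b) (hac : a ≤ c)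
    (h : a + d = b + c) : w a * w d ≤ w b * w c := by
  have key : ∀ (j : ℕ) (a d : ℤ), a + j ≤ d - j → w a * w d ≤ w (a + j) * w (d - j) := by
    intro j
    induction j with
    | zero => intro a d _; simp
    | succ j ih =>
      intro a d had
      push_cast at had
      have h1 := ih a d (by lia)
      have h2 := hw.mul_le (a + (j + 1)) (d - (j + 1)) (by lia)
      rw [show a + ((j : ℤ) + 1) - 1 = a + j by ring,
        show d - ((j : ℤ) + 1) + 1 = d - j by ring] at h2
      push_cast
      exact h1.trans h2
  rcases le_total b c with hbc | hbc
  · obtain ⟨j, hj⟩ := Int.eq_ofNat_of_zero_le (sub_nonneg.2 hab)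
    have := key j a d (by lia)
    rwa [show a + (j : ℤ) = b by lia, show d - (j : ℤ) = c by lia] at this
  · obtain ⟨j, hj⟩ := Int.eq_ofNat_of_zero_le (sub_nonneg.2 hac)
    have := key j a d (by lia)
    rwa [show a + (j : ℤ) = c by lia, show d - (j : ℤ) = b by lia, mul_comm (w c)] at this

/-- The sums of a Pólya frequency sequence over windows of a fixed length form a Pólya frequency
sequence. -/
theorem sum_window (hw : IsPolyaFreqSeq w) (N : ℕ) :
    IsPolyaFreqSeq fun p => ∑ i ∈ Finset.range N, w (p + i) where
  nonneg p := Finset.sum_nonneg fun i _ => hw.nonneg _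
  mul_le p q hpq := by
    -- Neighbouring windows differ by their two end terms. Substituting this for the windows at `p -
    -- 1` and `q` cancels the product of the windows at `p` and `q + 1`; what remains is `h1` and
    -- `h2`, which compare single terms.
    have shift : ∀ r : ℤ, (∑ i ∈ Finset.range N, w (r + i)) + w (r + N)
        = w r + ∑ i ∈ Finset.range N, w (r + 1 + i) := by
      intro r
      rw [← Finset.sum_range_succ (fun i : ℕ => w (r + i)),
        Finset.sum_range_succ' (fun i : ℕ => w (r + i)), add_comm]
      push_cast
      simp [add_assoc, add_comm (1 : ℤ)]
    have hp := shift (p - 1)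
    have hq := shift q
    rw [sub_add_cancel] at hp
    have h1 : w (p - 1) * ∑ i ∈ Finset.range N, w (q + 1 + i)
        ≤ (∑ i ∈ Finset.range N, w (p + i)) * w q := by
      rw [Finset.mul_sum, Finset.sum_mul]
      exact Finset.sum_le_sum fun i _ => hw.mul_le_mul_of_le (by lia) (by lia) (by ring)
    have h2 : (∑ i ∈ Finset.range N, w (p + i)) * w (q + N)
        ≤ w (p - 1 + N) * ∑ i ∈ Finset.range N, w (q + 1 + i) := by
      rw [Finset.mul_sum, Finset.sum_mul]
      refine Finset.sum_le_sum fun i hi => ?_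
      have := Finset.mem_range.1 hi
      exact hw.mul_le_mul_of_le (by lia) (by lia) (by ring)
    generalize (∑ i ∈ Finset.range N, w (p - 1 + i)) = A at *
    generalize (∑ i ∈ Finset.range N, w (p + i)) = B at *
    generalize (∑ i ∈ Finset.range N, w (q + i)) = C at *
    generalize (∑ i ∈ Finset.range N, w (q + 1 + i)) = D at *
    have hA : A = w (p - 1) + B - w (p - 1 + N) := by linarith
    have hC : C = w q + D - w (q + N) := by linarith
    rw [hA, hC]
    linarith

/-- A concave graph lies below the line through two of its points outside the interval between them.
For consecutive integers, that is everywhere. -/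
theorem le_mul_zpow (hw : IsPolyaFreqSeq w) {k : ℤ} (hk : 0 < w k) (hk' : 0 < w (k + 1)) (j : ℤ) :
    w j ≤ w k * (w (k + 1) / w k) ^ (j - k) := by
  have hr : 0 < w (k + 1) / w k := div_pos hk' hk
  rcases le_total k j with hj | hj
  · obtain ⟨i, hi⟩ := Int.eq_ofNat_of_zero_le (sub_nonneg.2 hj)
    obtain rfl : j = k + i := by lia
    clear hj hi
    rw [add_sub_cancel_left, zpow_natCast]
    induction i with
    | zero => simp
    | succ i ih =>
      have h := hw.mul_le_mul_of_le (a := k) (d := k + (i + 1)) (b := k + i) (c := k + 1)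
        (by lia) (by lia) (by ring)
      push_cast
      calc w (k + (i + 1)) = w k * w (k + (i + 1)) / w k := by field_simp
        _ ≤ w (k + i) * w (k + 1) / w k := by gcongr
        _ = w (k + i) * (w (k + 1) / w k) := by ring
        _ ≤ w k * (w (k + 1) / w k) ^ i * (w (k + 1) / w k) := by gcongr
        _ = _ := by ring
  · obtain ⟨i, hi⟩ := Int.eq_ofNat_of_zero_le (sub_nonneg.2 hj)
    obtain rfl : j = k - i := by lia
    clear hj hi
    rw [show k - (i : ℤ) - k = -(i : ℤ) by ring, zpow_neg, zpow_natCast, ← div_eq_mul_inv,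
      le_div_iff₀ (pow_pos hr i)]
    induction i with
    | zero => simp
    | succ i ih =>
      have h := hw.mul_le_mul_of_le (a := k - (i + 1)) (d := k + 1) (b := k - i) (c := k)
        (by lia) (by lia) (by ring)
      push_cast
      calc w (k - (i + 1)) * (w (k + 1) / w k) ^ (i + 1)
          = w (k - (i + 1)) * w (k + 1) / w k * (w (k + 1) / w k) ^ i := by ring
        _ ≤ w (k - i) * w k / w k * (w (k + 1) / w k) ^ i := by gcongr
        _ = w (k - i) * (w (k + 1) / w k) ^ i := by field_simp
        _ ≤ w k := ih

/-- The geometric majorant of `le_mul_zpow` is log-affine, so the weighted mean of its values at `m`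
and `n` is its value at the real index `l * m + (1 - l) * n`. -/
theorem rpow_mul_rpow_le (hw : IsPolyaFreqSeq w) {k : ℤ} (hk : 0 < w k) (hk' : 0 < w (k + 1))
    (m n : ℤ) {l : ℝ} (hl : 0 ≤ l) (hl' : l ≤ 1) :
    w m ^ l * w n ^ (1 - l) ≤ w k * (w (k + 1) / w k) ^ (l * m + (1 - l) * n - k) := by
  set r := w (k + 1) / w k with hrdef
  have hr : 0 < r := div_pos hk' hk
  have hm := hw.le_mul_zpow hk hk' m
  have hn := hw.le_mul_zpow hk hk' n
  have h1l : 0 ≤ 1 - l := by linarith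
  calc w m ^ l * w n ^ (1 - l)
      ≤ (w k * r ^ (m - k)) ^ l * (w k * r ^ (n - k)) ^ (1 - l) := by
        have := hw.nonneg m
        have := hw.nonneg n
        gcongr
    _ = (w k ^ l * w k ^ (1 - l)) * (r ^ (((m - k : ℤ) : ℝ) * l) *
          r ^ (((n - k : ℤ) : ℝ) * (1 - l))) := by
        rw [Real.mul_rpow hk.le (by positivity), Real.mul_rpow hk.le (by positivity),
          Real.rpow_mul hr.le, Real.rpow_mul hr.le, Real.rpow_intCast, Real.rpow_intCast]
        ring
    _ = _ := by
        rw [← Real.rpow_add hk, ← Real.rpow_add hr, add_sub_cancel, Real.rpow_one]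
        congr 2
        push_cast
        ring

theorem pos_of_mem_Icc (hw : IsPolyaFreqSeq w) {m n k : ℤ} (hm : 0 < w m) (hn : 0 < w n)
    (hmk : m ≤ k) (hkn : k ≤ n) : 0 < w k := by
  have h := hw.mul_le_mul_of_le (a := m) (d := n) (b := k) (c := m + n - k)
    hmk (by lia) (by ring)
  exact pos_of_mul_pos_left ((mul_pos hm hn).trans_le h) (hw.nonneg _)

theorem pos_of_mem_uIcc (hw : IsPolyaFreqSeq w) {m n k : ℤ} (hm : 0 < w m) (hn : 0 < w n)
    (hk : min m n ≤ k) (hk' : k ≤ max m n) : 0 < w k := by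
  rcases le_total m n with h | h
  · exact hw.pos_of_mem_Icc hm hn (by simpa [h] using hk) (by simpa [h] using hk')
  · exact hw.pos_of_mem_Icc hn hm (by simpa [h] using hk) (by simpa [h] using hk')

/-- A Pólya frequency sequence is log-concave, up to rounding of the intermediate index. -/
theorem rpow_mul_rpow_le_max (hw : IsPolyaFreqSeq w) {m n k : ℤ} {l : ℝ} (hl : 0 < l) (hl' : l < 1)
    (hk : (k : ℝ) ≤ l * m + (1 - l) * n) (hk' : l * m + (1 - l) * n < k + 1) :
    w m ^ l * w n ^ (1 - l) ≤ max (w k) (w (k + 1)) ∧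
      (l * m + (1 - l) * n = k → w m ^ l * w n ^ (1 - l) ≤ w k) := by
  have h1l : 0 < 1 - l := by linarith
  rcases (hw.nonneg m).eq_or_lt' with hm | hm
  · rw [hm, Real.zero_rpow hl.ne', zero_mul]
    exact ⟨(hw.nonneg k).trans (le_max_left _ _), fun _ => hw.nonneg k⟩
  rcases (hw.nonneg n).eq_or_lt' with hn | hn
  · rw [hn, Real.zero_rpow h1l.ne', mul_zero]
    exact ⟨(hw.nonneg k).trans (le_max_left _ _), fun _ => hw.nonneg k⟩
  rcases eq_or_ne m n with rfl | hmn
  · have hkm : k = m := by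
      have h1 : (k : ℝ) ≤ m := by linarith
      have h2 : (m : ℝ) < (k + 1 : ℤ) := by push_cast; linarith
      have := Int.cast_le.1 h1
      have := Int.cast_lt.1 h2
      lia
    subst hkm
    rw [← Real.rpow_add hm, add_sub_cancel, Real.rpow_one]
    exact ⟨le_max_left _ _, fun _ => le_rfl⟩
  -- Since `m ≠ n`, the mean is strictly between them, so `k` and `k + 1` both lie in their hull and
  -- `w` is positive there.
  have hmin : (min m n : ℤ) < l * m + (1 - l) * n ∧ l * m + (1 - l) * n < (max m n : ℤ) := by
    rcases lt_or_gt_of_ne hmn with h | h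
    · have h' : (m : ℝ) < n := Int.cast_lt.2 h
      rw [min_eq_left h.le, max_eq_right h.le]
      constructor <;> nlinarith
    · have h' : (n : ℝ) < m := Int.cast_lt.2 h
      rw [min_eq_right h.le, max_eq_left h.le]
      constructor <;> nlinarith
  have hlo : min m n < k + 1 := by
    have : ((min m n : ℤ) : ℝ) < (k + 1 : ℤ) := by
      push_cast at hmin ⊢
      linarith [hmin.1]
    exact Int.cast_lt.1 this
  have hhi : k < max m n := by
    have : (k : ℝ) < (max m n : ℤ) := hk.trans_lt hmin.2
    exact Int.cast_lt.1 this
  have hpk : 0 < w k := hw.pos_of_mem_uIcc hm hn (by lia) hhi.le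
  have hpk' : 0 < w (k + 1) := hw.pos_of_mem_uIcc hm hn hlo.le (by lia)
  have main := hw.rpow_mul_rpow_le hpk hpk' m n hl.le hl'.le
  constructor
  · refine main.trans ?_
    set θ := l * (m : ℝ) + (1 - l) * n - k
    have hθ : 0 ≤ θ := by simp only [θ]; linarith
    have hθ' : θ ≤ 1 := by simp only [θ]; linarith
    rcases le_total (w (k + 1) / w k) 1 with hr | hr
    · refine le_trans ?_ (le_max_left _ _)
      exact mul_le_of_le_one_right hpk.le (Real.rpow_le_one (div_pos hpk' hpk).le hr hθ)
    · refine le_trans ?_ (le_max_right _ _)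
      calc w k * (w (k + 1) / w k) ^ θ ≤ w k * (w (k + 1) / w k) ^ (1 : ℝ) := by gcongr
        _ = w (k + 1) := by rw [Real.rpow_one]; field_simp
  · intro h
    rw [h, sub_self, Real.rpow_zero, mul_one] at main
    exact main

end IsPolyaFreqSeq

/-! ### Log-concave sequences on `ℕ` as Pólya frequency sequences. -/

/-- The extension by zero to `ℤ` of a sequence. -/
def extendInt (a : ℕ → ℝ) (n : ℤ) : ℝ := if 0 ≤ n then a n.toNat else 0

@[simp]
theorem extendInt_natCast (a : ℕ → ℝ) (n : ℕ) : extendInt a n = a n := by simp [extendInt]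

theorem extendInt_of_neg (a : ℕ → ℝ) {n : ℤ} (hn : n < 0) : extendInt a n = 0 := by
  simp [extendInt, hn]

theorem isPolyaFreqSeq_extendInt {a : ℕ → ℝ} (h0 : ∀ n, 0 ≤ a n)
    (h : ∀ p q, p ≤ q → a p * a (q + 2) ≤ a (p + 1) * a (q + 1)) :
    IsPolyaFreqSeq (extendInt a) where
  nonneg n := by
    unfold extendInt
    split_ifs
    exacts [h0 _, le_rfl]
  mul_le p q hpq := by
    have hnn : ∀ n, 0 ≤ extendInt a n := by
      intro n
      unfold extendInt
      split_ifs
      exacts [h0 _, le_rfl]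
    rcases lt_or_ge (p - 1) 0 with hp | hp
    · rw [extendInt_of_neg a hp, zero_mul]
      exact mul_nonneg (hnn _) (hnn _)
    obtain ⟨i, hi⟩ := Int.eq_ofNat_of_zero_le hp
    obtain ⟨j, hj⟩ := Int.eq_ofNat_of_zero_le (show 0 ≤ q - 1 by lia)
    obtain rfl : p = (i + 1 : ℕ) := by push_cast; lia
    obtain rfl : q = (j + 1 : ℕ) := by push_cast; lia
    rw [show ((i + 1 : ℕ) : ℤ) - 1 = (i : ℕ) by push_cast; ring,
      show ((j + 1 : ℕ) : ℤ) + 1 = (j + 2 : ℕ) by push_cast; ring]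
    simp only [extendInt_natCast]
    exact h i j (by lia)

/-- The indices `p + 1` and `q + 1` are means of `p` and `q + 2` with complementary weights, so the
two log-concavity inequalities multiply to whole powers. -/
theorem IsLogConcaveSeq.mul_le {a : ℕ → ℝ} (ha : IsLogConcaveSeq a) {p q : ℕ} (hpq : p ≤ q) :
    a p * a (q + 2) ≤ a (p + 1) * a (q + 1) := by
  have hd : (0 : ℝ) < q + 2 - p := by
    have : (p : ℝ) ≤ q := Nat.cast_le.2 hpq
    linarith
  set l : ℝ := 1 / (q + 2 - p) with hl
  have hl0 : 0 < l := by positivity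
  have hl1 : l < 1 := by
    rw [hl, div_lt_one hd]
    have : (p : ℝ) ≤ q := Nat.cast_le.2 hpq
    linarith
  have hmul : l * (q + 2 - p) = 1 := by rw [hl]; field_simp
  have h1 := ha.2 p (q + 2) (p + 1) l hl0 hl1 (by push_cast; linarith)
  have h2 := ha.2 (q + 2) p (q + 1) l hl0 hl1 (by push_cast; linarith)
  have hp := ha.1 p
  have hq := ha.1 (q + 2)
  have split : ∀ x : ℝ, 0 ≤ x → x ^ l * x ^ (1 - l) = x := fun x hx => by
    rw [← Real.rpow_add' hx (by simp), add_sub_cancel, Real.rpow_one]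
  calc a p * a (q + 2)
      = (a p ^ l * a p ^ (1 - l)) * (a (q + 2) ^ l * a (q + 2) ^ (1 - l)) := by
        rw [split _ hp, split _ hq]
    _ = (a (q + 2) ^ l * a p ^ (1 - l)) * (a p ^ l * a (q + 2) ^ (1 - l)) := by ring
    _ ≤ a (p + 1) * a (q + 1) := by
        have := ha.1 (p + 1)
        gcongr

/-- A positive sequence with `a n * a (n + 2) ≤ a (n + 1) ^ 2` is log-concave. -/
theorem isLogConcaveSeq_of_pos {a : ℕ → ℝ} (hpos : ∀ n, 0 < a n)
    (h : ∀ n, a n * a (n + 2) ≤ a (n + 1) ^ 2) : IsLogConcaveSeq a := by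
  have key : ∀ p j, a p * a (p + j + 2) ≤ a (p + 1) * a (p + j + 1) := by
    intro p j
    induction j with
    | zero => simpa [sq] using h p
    | succ j ih =>
      have h1 := h (p + j + 1)
      have hc := hpos (p + j + 1)
      have hd := hpos (p + j + 2)
      rw [show p + (j + 1) + 2 = p + j + 1 + 2 by ring, show p + (j + 1) + 1 = p + j + 2 by ring]
      rw [show p + j + 1 + 1 = p + j + 2 by ring] at h1
      -- Positivity is essential for this cancellation: `1, 0, 0, 1` satisfies the three-term
      -- inequalities but has a gap.
      refine le_of_mul_le_mul_right ?_ (mul_pos hc hd)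
      calc a p * a (p + j + 1 + 2) * (a (p + j + 1) * a (p + j + 2))
          = (a p * a (p + j + 2)) * (a (p + j + 1) * a (p + j + 1 + 2)) := by ring
        _ ≤ (a (p + 1) * a (p + j + 1)) * a (p + j + 2) ^ 2 := by
            have := (hpos (p + 1)).le
            have := (hpos (p + j + 1 + 2)).le
            gcongr
        _ = _ := by ring
  have hw : IsPolyaFreqSeq (extendInt a) := by
    refine isPolyaFreqSeq_extendInt (fun n => (hpos n).le) fun p q hpq => ?_
    obtain ⟨j, rfl⟩ := Nat.exists_eq_add_of_le hpq
    exact key p j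
  refine ⟨fun n => (hpos n).le, fun m n k l hl hl' hk => ?_⟩
  have := (hw.rpow_mul_rpow_le_max (m := n) (n := m) (k := k) hl hl'
    (by push_cast; linarith) (by push_cast; linarith)).2 (by push_cast; linarith)
  simpa using this

/-! ### Taylor expansion under alternating signs. -/

open Filter Topology in
/-- The Taylor series at `t` of a function on `(0, ∞)` whose derivatives alternate in sign converges
to the function on `(0, t]`. -/
theorem hasSum_altTaylorCoeff {φ : ℝ → ℝ} (hsmooth : ContDiffOn ℝ ∞ φ (Ioi 0))
    (hnn : ∀ t, 0 < t → ∀ n, 0 ≤ altTaylorCoeff φ t n) {s t : ℝ} (hs : 0 < s) (hst : s ≤ t) :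
    HasSum (fun n => altTaylorCoeff φ t n * (t - s) ^ n) (φ s) := by
  -- Cauchy's form of the remainder: its factor `(ξ - s) ^ n` is small precisely when `ξ` is near
  -- `s`, which the factor `(t - s) ^ (n + 1)` of Lagrange's form is not.
  have key : ∀ s t : ℝ, 0 < s → s < t → ∀ n : ℕ, ∃ ξ ∈ Ioo s t,
      φ s - ∑ k ∈ Finset.range (n + 1), altTaylorCoeff φ t k * (t - s) ^ k =
        (n + 1) * altTaylorCoeff φ ξ (n + 1) * (ξ - s) ^ n * (t - s) := by
    intro s t hs hst n
    have hsub : uIcc t s ⊆ Ioi 0 := fun x hx => hs.trans_le (by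
      rw [uIcc_of_ge hst.le] at hx
      exact hx.1)
    have hcd : ∀ x ∈ uIcc t s, ∀ k : ℕ, ContDiffAt ℝ k φ x := fun x hx k =>
      ((hsmooth.of_le (by exact_mod_cast le_top)).contDiffAt (Ioi_mem_nhds (hsub hx)))
    have hu : UniqueDiffOn ℝ (uIcc t s) := uniqueDiffOn_uIcc hst.ne'
    have hder : ∀ x ∈ uIcc t s, ∀ k : ℕ,
        iteratedDerivWithin k φ (uIcc t s) x = iteratedDeriv k φ x := fun x hx k =>
      iteratedDerivWithin_eq_iteratedDeriv hu (hcd x hx k) hx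
    have hon : ∀ k : ℕ, ContDiffOn ℝ k φ (uIcc t s) := fun k x hx =>
      (hcd x hx k).contDiffWithinAt
    obtain ⟨ξ, hξ, h⟩ := taylor_mean_remainder_cauchy (f := φ) (x := s) (x₀ := t) (n := n) hst.ne'
      (hon n) (((hon (n + 1)).differentiableOn_iteratedDerivWithin
        (by exact_mod_cast Nat.lt_succ_self n) hu).mono uIoo_subset_uIcc_self)
    have hξ' := uIoo_subset_uIcc_self hξ
    rw [uIoo_of_ge hst.le] at hξ
    refine ⟨ξ, hξ, ?_⟩
    rw [taylor_within_apply, hder ξ hξ'] at h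
    have hsgn : ∀ k : ℕ, ((-1 : ℝ) ^ k) * (-1) ^ k = 1 := fun k => by
      rw [← mul_pow]; simp
    have hneg : ∀ (x y : ℝ) (k : ℕ), (x - y) ^ k = (-1) ^ k * (y - x) ^ k := fun x y k => by
      rw [← mul_pow]; ring
    have hsum : ∀ k ∈ Finset.range (n + 1), altTaylorCoeff φ t k * (t - s) ^ k =
        ((k.factorial : ℝ)⁻¹ * (s - t) ^ k) • iteratedDerivWithin k φ (uIcc t s) t := by
      intro k _
      rw [hder t left_mem_uIcc, altTaylorCoeff, hneg t s, smul_eq_mul]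
      linear_combination (iteratedDeriv k φ t / k.factorial * (s - t) ^ k) * hsgn k
    rw [Finset.sum_congr rfl hsum, h, altTaylorCoeff, Nat.factorial_succ, hneg ξ s]
    have : (n.factorial : ℝ) ≠ 0 := by positivity
    push_cast
    field_simp
    linear_combination (iteratedDeriv (n + 1) φ ξ * (s - ξ) ^ n * (s - t)) * -hsgn n
  have partial_le : ∀ s t : ℝ, 0 < s → s < t → ∀ n : ℕ,
      ∑ k ∈ Finset.range (n + 1), altTaylorCoeff φ t k * (t - s) ^ k ≤ φ s := by
    intro s t hs hst n
    obtain ⟨ξ, hξ, h⟩ := key s t hs hst n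
    have h1 := hnn ξ (hs.trans hξ.1) (n + 1)
    have h2 : 0 ≤ ξ - s := by linarith [hξ.1]
    have h3 : 0 ≤ t - s := by linarith
    have : 0 ≤ (n + 1) * altTaylorCoeff φ ξ (n + 1) * (ξ - s) ^ n * (t - s) := by positivity
    linarith
  have term_le : ∀ s t : ℝ, 0 < s → s < t → ∀ n : ℕ,
      altTaylorCoeff φ t n * (t - s) ^ n ≤ φ s := by
    intro s t hs hst n
    refine le_trans ?_ (partial_le s t hs hst n)
    refine Finset.single_le_sum (f := fun k => altTaylorCoeff φ t k * (t - s) ^ k)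
      (fun k _ => ?_) (Finset.self_mem_range_succ n)
    have := hnn t (hs.trans hst) k
    have : 0 ≤ t - s := by linarith
    positivity
  rcases hst.eq_or_lt with rfl | hst
  · have : φ s = altTaylorCoeff φ s 0 * (s - s) ^ 0 := by simp [altTaylorCoeff]
    rw [this]
    exact hasSum_single 0 fun n hn => by simp [hn]
  have ht := hs.trans hst
  have hts : 0 < t - s := sub_pos.2 hst
  rw [hasSum_iff_tendsto_nat_of_nonneg (fun n => mul_nonneg (hnn t ht n) (by positivity)),
    ← tendsto_add_atTop_iff_nat 1]
  -- Any point of `(0, s)` would do. Expanding from `ξ` down to `s'` bounds the coefficient at `ξ`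
  -- by `φ s'` over a power of `ξ - s'`, and `(ξ - s) / (ξ - s')`, increasing in `ξ`, is at most `q
  -- < 1`. The remainder is thus `O((n + 1) q ^ n)`.
  set s' := s / 2 with hs'
  have hs'0 : 0 < s' := by positivity
  have hs's : s' < s := by rw [hs']; linarith
  set q := (t - s) / (t - s') with hq
  have hts' : 0 < t - s' := by linarith
  have hq0 : 0 ≤ q := by positivity
  have hq1 : q < 1 := by rw [hq, div_lt_one hts']; linarith
  set C := φ s' * (t - s) / (s - s') with hC
  have hlim : Tendsto (fun n : ℕ => C * ((n * q ^ n) + q ^ n)) atTop (𝓝 (C * (0 + 0))) :=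
    ((tendsto_self_mul_const_pow_of_lt_one hq0 hq1).add
      (tendsto_pow_atTop_nhds_zero_of_lt_one hq0 hq1)).const_mul C
  rw [add_zero, mul_zero] at hlim
  have hlim2 : Tendsto (fun n : ℕ => φ s - C * ((n * q ^ n) + q ^ n)) atTop (𝓝 (φ s)) := by
    simpa using tendsto_const_nhds.sub hlim
  refine tendsto_of_tendsto_of_tendsto_of_le_of_le hlim2 tendsto_const_nhds (fun n => ?_)
    (fun n => partial_le s t hs hst n)
  simp only
  obtain ⟨ξ, hξ, h⟩ := key s t hs hst n
  have hb := term_le s' ξ hs'0 (hs's.trans hξ.1) (n + 1)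
  have hξs : 0 < ξ - s := sub_pos.2 hξ.1
  have hξs' : 0 < ξ - s' := by linarith
  have hφ : 0 ≤ φ s' := by simpa [altTaylorCoeff] using hnn s' hs'0 0
  have hA := hnn ξ (hs.trans hξ.1) (n + 1)
  have hratio : ξ - s ≤ q * (ξ - s') := by
    rw [hq, div_mul_eq_mul_div, le_div_iff₀ hts']
    nlinarith [hξ.2]
  have hbound : altTaylorCoeff φ ξ (n + 1) * (ξ - s') ^ n * (s - s') ≤ φ s' := by
    refine le_trans ?_ hb
    rw [pow_succ, ← mul_assoc]
    gcongr
    exact hξ.1.le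
  have : altTaylorCoeff φ ξ (n + 1) * (ξ - s) ^ n ≤ φ s' / (s - s') * q ^ n := by
    calc altTaylorCoeff φ ξ (n + 1) * (ξ - s) ^ n
        ≤ altTaylorCoeff φ ξ (n + 1) * (q * (ξ - s')) ^ n := by gcongr
      _ = (altTaylorCoeff φ ξ (n + 1) * (ξ - s') ^ n) * q ^ n := by rw [mul_pow]; ring
      _ ≤ φ s' / (s - s') * q ^ n := by
          gcongr
          rwa [le_div_iff₀ (by linarith)]
  have : φ s - ∑ k ∈ Finset.range (n + 1), altTaylorCoeff φ t k * (t - s) ^ k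
      ≤ C * (n * q ^ n + q ^ n) := by
    rw [h]
    calc (n + 1) * altTaylorCoeff φ ξ (n + 1) * (ξ - s) ^ n * (t - s)
        = (n + 1) * (altTaylorCoeff φ ξ (n + 1) * (ξ - s) ^ n) * (t - s) := by ring
      _ ≤ (n + 1) * (φ s' / (s - s') * q ^ n) * (t - s) := by gcongr
      _ = _ := by rw [hC]; ring
  linarith

/-! ### Borell's theorem on the line, by differentiation of measures. -/

section
open Filter Topology ENNReal

/-- A measure on `ℝ` is log-concave on balls if `x ↦ μ (closedBall x h)` is log-concave for all
`h > 0`. -/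
def LogConcaveOnBalls (μ : Measure ℝ) : Prop :=
  ∀ (x y h l : ℝ), 0 < h → 0 < l → l < 1 →
    μ (Metric.closedBall x h) ^ l * μ (Metric.closedBall y h) ^ (1 - l) ≤
      μ (Metric.closedBall (l * x + (1 - l) * y) h)

/-- The lower density of a measure on `ℝ` with respect to Lebesgue measure. -/
noncomputable def lowerDensity (μ : Measure ℝ) (x : ℝ) : ℝ≥0∞ :=
  liminf (fun h => μ (Metric.closedBall x h) / volume (Metric.closedBall x h)) (𝓝[>] 0)

/-- The volume of a ball depends only on its radius, and a product of lower limits is at most the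
lower limit of the product. Using a lower limit gives log-concavity at every point, not just almost
everywhere. -/
theorem LogConcaveOnBalls.lowerDensity_rpow_mul_le {μ : Measure ℝ} (hμ : LogConcaveOnBalls μ)
    (x y : ℝ) {l : ℝ} (hl : 0 < l) (hl' : l < 1) :
    lowerDensity μ x ^ l * lowerDensity μ y ^ (1 - l) ≤ lowerDensity μ (l * x + (1 - l) * y) := by
  have h1l : 0 < 1 - l := by linarith
  have hliminf : ∀ (u : ℝ → ℝ≥0∞) (p : ℝ), 0 < p →
      (liminf u (𝓝[>] (0 : ℝ))) ^ p = liminf (fun h => u h ^ p) (𝓝[>] (0 : ℝ)) := fun u p hp =>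
    (ENNReal.orderIsoRpow p hp).liminf_apply
  unfold lowerDensity
  rw [hliminf _ l hl, hliminf _ _ h1l]
  refine ENNReal.le_liminf_mul.trans (liminf_le_liminf ?_)
  filter_upwards [self_mem_nhdsWithin] with h hh
  have hh : 0 < h := hh
  simp only [Pi.mul_apply, Real.volume_closedBall]
  set v := ENNReal.ofReal (2 * h)
  have hv : v ≠ 0 := by simp [v, hh]
  have hv' : v ≠ ⊤ := ofReal_ne_top
  rw [ENNReal.div_rpow_of_nonneg _ _ hl.le, ENNReal.div_rpow_of_nonneg _ _ h1l.le,
    ENNReal.div_eq_inv_mul, ENNReal.div_eq_inv_mul, ENNReal.div_eq_inv_mul]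
  calc (v ^ l)⁻¹ * μ (Metric.closedBall x h) ^ l *
        ((v ^ (1 - l))⁻¹ * μ (Metric.closedBall y h) ^ (1 - l))
      = (v ^ l * v ^ (1 - l))⁻¹ *
        (μ (Metric.closedBall x h) ^ l * μ (Metric.closedBall y h) ^ (1 - l)) := by
        rw [ENNReal.mul_inv (Or.inr (by simp [hv', hl'.le])) (Or.inr (by simp [hv, hv']))]
        ring
    _ ≤ v⁻¹ * μ (Metric.closedBall (l * x + (1 - l) * y) h) := by
        rw [← ENNReal.rpow_add _ _ hv hv', add_sub_cancel, ENNReal.rpow_one]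
        gcongr
        exact hμ x y h l hh hl hl'

theorem lowerDensity_ae_eq_rnDeriv (μ : Measure ℝ) [IsFiniteMeasure μ] :
    lowerDensity μ =ᵐ[volume] μ.rnDeriv volume := by
  filter_upwards [Besicovitch.ae_tendsto_rnDeriv μ volume] with x hx using hx.liminf_eq

/-- Differentiate the other way round: `μ`-almost everywhere the lower density is the inverse of the
density of `volume` with respect to `μ`, which is finite. -/
theorem lowerDensity_pos_ae (μ : Measure ℝ) [IsFiniteMeasure μ] :
    ∀ᵐ x ∂μ, 0 < lowerDensity μ x := by
  filter_upwards [Besicovitch.ae_tendsto_rnDeriv volume μ,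
    Measure.rnDeriv_lt_top volume μ] with x hx hx'
  have h := (continuous_inv.tendsto _).comp hx
  have : lowerDensity μ x = (volume.rnDeriv μ x)⁻¹ := by
    refine Tendsto.liminf_eq (h.congr' ?_)
    filter_upwards [self_mem_nhdsWithin] with r hr
    have hr : 0 < r := hr
    simp only [Function.comp_apply]
    rw [ENNReal.inv_div (Or.inr measure_closedBall_lt_top.ne) (Or.inr (by simp [hr]))]
  rw [this]
  simpa using hx'.ne

/-- The same inversion: on a Lebesgue-null set the density of `volume` with respect to `μ` vanishes
`μ`-almost everywhere. A singular part therefore shows up as infinite lower density. -/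
theorem lowerDensity_eq_top_ae (μ : Measure ℝ) [IsFiniteMeasure μ] {s : Set ℝ}
    (hs : MeasurableSet s) (hs0 : volume s = 0) : ∀ᵐ x ∂μ, x ∈ s → lowerDensity μ x = ⊤ := by
  have hzero : ∀ᵐ x ∂μ, x ∈ s → volume.rnDeriv μ x = 0 := by
    rw [← ae_restrict_iff' hs]
    have h := Measure.setLIntegral_rnDeriv_le (μ := volume) (ν := μ) s
    rw [hs0, nonpos_iff_eq_zero, lintegral_eq_zero_iff (Measure.measurable_rnDeriv _ _)] at h
    exact h
  filter_upwards [Besicovitch.ae_tendsto_rnDeriv volume μ, hzero] with x hx hx0 hxs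
  rw [hx0 hxs] at hx
  have h := (continuous_inv.tendsto _).comp hx
  rw [ENNReal.inv_zero] at h
  refine Tendsto.liminf_eq (h.congr' ?_)
  filter_upwards [self_mem_nhdsWithin] with r hr
  have hr : 0 < r := hr
  simp only [Function.comp_apply]
  rw [ENNReal.inv_div (Or.inr measure_closedBall_lt_top.ne) (Or.inr (by simp [hr]))]

theorem absolutelyContinuous_of_lowerDensity_lt_top (μ : Measure ℝ) [IsFiniteMeasure μ]
    (h : ∀ x, lowerDensity μ x < ⊤) : μ ≪ volume := by
  refine Measure.AbsolutelyContinuous.mk fun s hs hs0 => ?_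
  have := lowerDensity_eq_top_ae μ hs hs0
  rw [measure_eq_zero_iff_ae_notMem]
  filter_upwards [this] with x hx hxs
  exact (h x).ne (hx hxs)

/-- The support of the lower density is reduced to a point where it is infinite, if there is one. -/
theorem LogConcaveOnBalls.lowerDensity_eq_zero {μ : Measure ℝ} [IsFiniteMeasure μ]
    (hμ : LogConcaveOnBalls μ) {x y : ℝ} (hx : lowerDensity μ x = ⊤) (hxy : y ≠ x) :
    lowerDensity μ y = 0 := by
  by_contra hy
  -- Log-concavity spreads an infinite value over the open segment towards any point of positive
  -- density, but the lower density is finite Lebesgue-almost everywhere.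
  have htop : ∀ z ∈ openSegment ℝ x y, lowerDensity μ z = ⊤ := by
    rintro z ⟨a, b, ha, hb, hab, rfl⟩
    have h := hμ.lowerDensity_rpow_mul_le x y ha (by linarith)
    obtain rfl : b = 1 - a := by linarith
    rw [hx, ENNReal.top_rpow_of_pos ha, ENNReal.top_mul] at h
    · simpa using h
    · rw [Ne, ENNReal.rpow_eq_zero_iff]
      rintro (⟨h0, -⟩ | ⟨-, h0⟩)
      exacts [hy h0, by linarith]
  have hnull : volume (openSegment ℝ x y) = 0 := by
    have hae : ∀ᵐ z, lowerDensity μ z < ⊤ := by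
      filter_upwards [lowerDensity_ae_eq_rnDeriv μ, Measure.rnDeriv_lt_top μ volume] with z hz hz'
      rwa [hz]
    refine measure_mono_null (fun z hz => ?_) hae
    simp [htop z hz]
  rw [openSegment_eq_Ioo' hxy.symm, Real.volume_Ioo] at hnull
  simp only [ofReal_eq_zero, tsub_le_iff_right, zero_add, max_le_iff, le_min_iff] at hnull
  exact hxy (le_antisymm hnull.1.2 hnull.2.1)

/-- **Borell's theorem** on the line: a finite measure on the half-line which is log-concave on
balls is a multiple of a Dirac mass or has a log-concave density. -/
theorem LogConcaveOnBalls.isLogConcaveMeasureOnHalfLine {μ : Measure ℝ} [IsFiniteMeasure μ]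
    (hμ : LogConcaveOnBalls μ) (hsupp : μ (Iio 0) = 0) : IsLogConcaveMeasureOnHalfLine μ := by
  by_cases htop : ∃ x, lowerDensity μ x = ⊤
  · left
    obtain ⟨x, hx⟩ := htop
    have hae : μ {x}ᶜ = 0 := by
      refine measure_mono_null (fun y hy => ?_) (lowerDensity_pos_ae μ)
      simp [hμ.lowerDensity_eq_zero hx hy]
    have hdirac : μ = (μ {x}).toNNReal • Measure.dirac x := by
      have h1 : μ.restrict {x} = μ := Measure.restrict_eq_self_of_ae_mem
        hae
      rw [Measure.restrict_singleton] at h1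
      ext s hs
      conv_lhs => rw [← h1]
      rw [Measure.smul_apply, Measure.smul_apply, ENNReal.smul_def,
        ENNReal.coe_toNNReal (measure_ne_top μ _)]
    rcases lt_or_ge x 0 with hx0 | hx0
    -- A point `x < 0` carries no mass, so `μ = 0`, written as a null multiple of a Dirac mass.
    · refine ⟨0, 0, le_rfl, ?_⟩
      have : μ {x} = 0 := measure_mono_null (by simpa using hx0) hsupp
      rw [hdirac, this]
      simp
    · exact ⟨_, x, hx0, hdirac⟩
  · right
    push Not at htop
    have hlt : ∀ x, lowerDensity μ x < ⊤ := fun x => (htop x).lt_top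
    have hac := absolutelyContinuous_of_lowerDensity_lt_top μ hlt
    refine ⟨fun x => (lowerDensity μ x).toReal, ⟨convex_Ici 0, fun _ _ => toReal_nonneg, ?_⟩, ?_⟩
    · intro x _ y _ l hl hl'
      rw [ENNReal.toReal_rpow, ENNReal.toReal_rpow, ← ENNReal.toReal_mul]
      exact ENNReal.toReal_mono (htop _) (hμ.lowerDensity_rpow_mul_le x y hl hl')
    · have h1 : μ.restrict (Ici 0) = μ := Measure.restrict_eq_self_of_ae_mem
        (by rw [ae_iff]; simpa [Iio_def] using hsupp)
      have h2 : volume.withDensity (lowerDensity μ) = μ := by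
        rw [withDensity_congr_ae (lowerDensity_ae_eq_rnDeriv μ)]
        exact Measure.withDensity_rnDeriv_eq μ volume hac
      simp_rw [ENNReal.ofReal_toReal (htop _)]
      conv_lhs => rw [← h1, ← h2]
      exact restrict_withDensity measurableSet_Ici _

end

/-! ### Laplace transforms of log-concave measures: from (ii) to (i). -/

section
open Filter Topology

/-- The exponential is log-affine, so `F` dominates it strictly on a convex set. With `β = 0` these
are the ordinary superlevel sets, which gives measurability. -/
theorem IsLogConcaveOn.ordConnected_superlevel_exp {K : Set ℝ} {F : ℝ → ℝ}
    (hF : IsLogConcaveOn K F) {α : ℝ} (hα : 0 ≤ α) (β : ℝ) :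
    OrdConnected {x | x ∈ K ∧ α * Real.exp (-(β * x)) < F x} := by
  refine Convex.ordConnected fun x hx y hy a b ha hb hab => ?_
  obtain ⟨hxK, hx⟩ := hx
  obtain ⟨hyK, hy⟩ := hy
  rcases ha.eq_or_lt with rfl | ha
  · obtain rfl : b = 1 := by linarith
    simpa using ⟨hyK, hy⟩
  rcases hb.eq_or_lt with rfl | hb
  · obtain rfl : a = 1 := by linarith
    simpa using ⟨hxK, hx⟩
  refine ⟨hF.1 hxK hyK ha.le hb.le hab, ?_⟩
  obtain rfl : b = 1 - a := by linarith
  refine lt_of_lt_of_le ?_ (hF.2.2 x hxK y hyK a ha (by linarith))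
  have hsplit : α * Real.exp (-(β * (a • x + (1 - a) • y))) =
      (α * Real.exp (-(β * x))) ^ a * (α * Real.exp (-(β * y))) ^ (1 - a) := by
    rw [Real.mul_rpow hα (Real.exp_pos _).le, Real.mul_rpow hα (Real.exp_pos _).le,
      ← Real.exp_mul, ← Real.exp_mul, mul_mul_mul_comm, ← Real.exp_add,
      ← Real.rpow_add' hα (by simp), add_sub_cancel, Real.rpow_one]
    congr 2
    simp only [smul_eq_mul]
    ring
  rw [hsplit]
  have h1 : 0 ≤ α * Real.exp (-(β * x)) := by positivity
  have h2 : 0 ≤ α * Real.exp (-(β * y)) := by positivity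
  exact mul_lt_mul'' (Real.rpow_lt_rpow h1 hx ha) (Real.rpow_lt_rpow h2 hy hb) (by positivity)
    (by positivity)

theorem IsLogConcaveOn.aemeasurable {K : Set ℝ} {F : ℝ → ℝ}
    (hF : IsLogConcaveOn K F) : AEMeasurable F (volume.restrict K) := by
  have hK : MeasurableSet K := hF.1.ordConnected.measurableSet
  rw [← aemeasurable_indicator_iff hK]
  refine (measurable_of_Ioi fun c => ?_).aemeasurable
  have hnn : ∀ x, 0 ≤ K.indicator F x := fun x => indicator_nonneg hF.2.1 x
  rcases lt_or_ge c 0 with hc | hc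
  · convert MeasurableSet.univ
    ext x
    simpa using hc.trans_le (hnn x)
  · convert (hF.ordConnected_superlevel_exp hc 0).measurableSet
    ext x
    by_cases hx : x ∈ K <;> simp [hx, hc]

theorem integrableOn_pow_mul_exp_neg {β : ℝ} (hβ : 0 < β) (n : ℕ) :
    IntegrableOn (fun x : ℝ => x ^ n * Real.exp (-(β * x))) (Ioi 0) := by
  have := integrableOn_rpow_mul_exp_neg_mul_rpow (p := 1) (s := n) (b := β)
    (by linarith [n.cast_nonneg (α := ℝ)]) one_pos hβ
  simpa using this

theorem integral_pow_mul_exp_neg {β : ℝ} (hβ : 0 < β) (n : ℕ) :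
    ∫ x in Ioi (0 : ℝ), x ^ n * Real.exp (-(β * x)) = n.factorial / β ^ (n + 1) := by
  have := Real.integral_rpow_mul_exp_neg_mul_Ioi (a := n + 1) (r := β) (by positivity) hβ
  rw [Real.Gamma_nat_eq_factorial, add_sub_cancel_right] at this
  simp only [Real.rpow_natCast] at this
  rw [this]
  norm_cast
  rw [one_div, inv_pow]
  ring

/-- If `h` is positive exactly on an interval of `(0, ∞)`, and the moments of `h` of orders `n` and
`n + 2` vanish, then the moment of order `n + 1` is nonnegative. -/
theorem integral_pow_mul_nonneg_of_ordConnected {h : ℝ → ℝ} {n : ℕ}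
    (hS : OrdConnected {x | x ∈ Ioi 0 ∧ 0 < h x})
    (hint : ∀ k, IntegrableOn (fun x => x ^ k * h x) (Ioi 0))
    (h0 : ∫ x in Ioi (0 : ℝ), x ^ n * h x = 0) (h2 : ∫ x in Ioi (0 : ℝ), x ^ (n + 2) * h x = 0) :
    0 ≤ ∫ x in Ioi (0 : ℝ), x ^ (n + 1) * h x := by
  set S := {x | x ∈ Ioi 0 ∧ 0 < h x} with hSdef
  -- If `(x - a) * (x - b)` has the sign opposite to `h`, integrating `x ^ n` times the product
  -- leaves only `-(a + b)` times the moment of order `n + 1`.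
  have quad : ∀ a b : ℝ, 0 < a + b → (∀ x, 0 < x → (x - a) * (x - b) * h x ≤ 0) →
      0 ≤ ∫ x in Ioi (0 : ℝ), x ^ (n + 1) * h x := by
    intro a b hab hle
    have h1 : ∫ x in Ioi (0 : ℝ), x ^ n * ((x - a) * (x - b) * h x) ≤ 0 :=
      setIntegral_nonpos measurableSet_Ioi fun x hx =>
        mul_nonpos_of_nonneg_of_nonpos (pow_nonneg (le_of_lt hx) n) (hle x hx)
    have h3 : (fun x => x ^ n * ((x - a) * (x - b) * h x)) = fun x =>
        x ^ (n + 2) * h x - (a + b) * (x ^ (n + 1) * h x) + (a * b) * (x ^ n * h x) := by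
      ext x
      ring
    have h4 : IntegrableOn (fun x => x ^ (n + 2) * h x - (a + b) * (x ^ (n + 1) * h x)) (Ioi 0) :=
      (hint _).sub ((hint _).const_mul _)
    rw [h3, integral_add h4 ((hint _).const_mul _), integral_sub (hint _) ((hint _).const_mul _), integral_const_mul, integral_const_mul, h0,
      h2] at h1
    nlinarith
  have hneg : ∀ x, 0 < x → x ∉ S → h x ≤ 0 := fun x hx hxS => not_lt.1 fun hlt => hxS ⟨hx, hlt⟩
  rcases S.eq_empty_or_nonempty with hempty | hne
  · refine quad 1 1 (by norm_num) fun x hx => ?_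
    exact mul_nonpos_of_nonneg_of_nonpos (mul_self_nonneg _) (hneg x hx (by simp [hempty]))
  have hbdd : BddBelow S := ⟨0, fun x hx => le_of_lt hx.1⟩
  have ha : 0 ≤ sInf S := le_csInf hne fun x hx => le_of_lt hx.1
  have hlow : ∀ x, 0 < x → x < sInf S → h x ≤ 0 := fun x hx hlt =>
    hneg x hx fun hxS => (csInf_le hbdd hxS).not_gt hlt
  by_cases hbdd' : BddAbove S
  · refine quad (sInf S) (sSup S) ?_ fun x hx => ?_
    · obtain ⟨x, hx⟩ := hne
      have : 0 < x := hx.1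
      linarith [le_csSup hbdd' hx]
    · rcases lt_or_ge x (sInf S) with hxa | hxa
      · have : sInf S ≤ sSup S := csInf_le_csSup hne hbdd hbdd'
        exact mul_nonpos_of_nonneg_of_nonpos (mul_nonneg_of_nonpos_of_nonpos (by linarith)
          (by linarith)) (hlow x hx hxa)
      rcases lt_or_ge (sSup S) x with hxb | hxb
      · exact mul_nonpos_of_nonneg_of_nonpos (mul_nonneg (by linarith) (by linarith))
          (hneg x hx fun hxS => (le_csSup hbdd' hxS).not_gt hxb)
      -- The endpoints may or may not belong to `S`; there the quadratic factor vanishes.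
      rcases hxa.eq_or_lt with hxa | hxa
      · simp [← hxa]
      rcases hxb.eq_or_lt with hxb | hxb
      · simp [← hxb]
      obtain ⟨y, hy, hyx⟩ := exists_lt_of_csInf_lt hne hxa
      obtain ⟨z, hz, hxz⟩ := exists_lt_of_lt_csSup hne hxb
      have hxS : x ∈ S := hS.out hy hz ⟨hyx.le, hxz.le⟩
      exact mul_nonpos_of_nonpos_of_nonneg
        (mul_nonpos_of_nonneg_of_nonpos (by linarith) (by linarith)) hxS.2.le
  -- With `S` unbounded above there is only one sign change, at `sInf S`, so a linear factor
  -- suffices.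
  · have h1 : 0 ≤ ∫ x in Ioi (0 : ℝ), x ^ n * ((x - sInf S) * h x) := by
      refine setIntegral_nonneg measurableSet_Ioi fun x hx =>
        mul_nonneg (pow_nonneg (le_of_lt hx) n) ?_
      rcases lt_or_ge x (sInf S) with hxa | hxa
      · exact mul_nonneg_of_nonpos_of_nonpos (by linarith) (hlow x hx hxa)
      rcases hxa.eq_or_lt with hxa | hxa
      · simp [← hxa]
      obtain ⟨y, hy, hyx⟩ := exists_lt_of_csInf_lt hne hxa
      obtain ⟨z, hz, hxz⟩ := not_bddAbove_iff.1 hbdd' x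
      have hxS : x ∈ S := hS.out hy hz ⟨hyx.le, hxz.le⟩
      exact mul_nonneg (by linarith) hxS.2.le
    have h3 : (fun x => x ^ n * ((x - sInf S) * h x)) = fun x =>
        x ^ (n + 1) * h x - sInf S * (x ^ n * h x) := by
      ext x
      ring
    rw [h3, integral_sub (hint _) ((hint _).const_mul _), integral_const_mul, h0] at h1
    linarith

/-- The normalized moments of a log-concave function on the half-line form a log-concave
sequence. -/
theorem IsLogConcaveOn.isLogConcaveSeq_moments {F : ℝ → ℝ} (hF : IsLogConcaveOn (Ioi 0) F)
    (hint : ∀ k : ℕ, IntegrableOn (fun x => x ^ k * F x) (Ioi 0)) :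
    IsLogConcaveSeq fun n => (∫ x in Ioi (0 : ℝ), x ^ n * F x) / n.factorial := by
  have hnn : ∀ k : ℕ, 0 ≤ᵐ[volume.restrict (Ioi 0)] fun x => x ^ k * F x := fun k =>
    (ae_restrict_iff' measurableSet_Ioi).2 (ae_of_all _ fun x hx =>
      mul_nonneg (pow_nonneg (le_of_lt hx) k) (hF.2.1 x hx))
  by_cases hzero : F =ᵐ[volume.restrict (Ioi 0)] 0
  · have : (fun n : ℕ => (∫ x in Ioi (0 : ℝ), x ^ n * F x) / n.factorial) = fun _ => 0 := by
      ext n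
      rw [integral_eq_zero_of_ae, zero_div]
      filter_upwards [hzero] with x hx
      simp [hx]
    rw [this]
    exact ⟨fun _ => le_rfl, fun m n k l hl hl' _ => by rw [Real.zero_rpow hl.ne', zero_mul]⟩
  have hpos : ∀ n : ℕ, 0 < (∫ x in Ioi (0 : ℝ), x ^ n * F x) / n.factorial := by
    intro n
    refine div_pos ((integral_nonneg_of_ae (hnn n)).lt_of_ne' fun h => hzero ?_) (by positivity)
    rw [integral_eq_zero_iff_of_nonneg_ae (hnn n) (hint n)] at h
    filter_upwards [h, ae_restrict_mem measurableSet_Ioi] with x hx hx0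
    have hx0 : 0 < x := hx0
    simpa [hx0.ne'] using hx
  refine isLogConcaveSeq_of_pos hpos fun n => ?_
  set a : ℕ → ℝ := fun n => (∫ x in Ioi (0 : ℝ), x ^ n * F x) / n.factorial with ha
  have hmom : ∀ k, ∫ x in Ioi (0 : ℝ), x ^ k * F x = a k * k.factorial := fun k => by
    rw [ha]
    have : (k.factorial : ℝ) ≠ 0 := by positivity
    field_simp
  change a n * a (n + 2) ≤ a (n + 1) ^ 2
  have hn := hpos n
  have hn2 := hpos (n + 2)
  change 0 < a n at hn
  change 0 < a (n + 2) at hn2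
  -- The normalized moments of `α e^{-βx}` are `α / β ^ (k + 1)`; `α` and `β` solve the equations
  -- that they equal `a k` for `k = n` and `k = n + 2`.
  set β := √(a n / a (n + 2)) with hβdef
  have hβ : 0 < β := Real.sqrt_pos.2 (div_pos hn hn2)
  have hβ2 : β ^ 2 * a (n + 2) = a n := by
    rw [hβdef, Real.sq_sqrt (div_pos hn hn2).le]
    field_simp
  set α := a n * β ^ (n + 1) with hα
  have hα0 : 0 < α := by positivity
  have hgint : ∀ k : ℕ, IntegrableOn (fun x => x ^ k * (α * Real.exp (-(β * x)))) (Ioi 0) := by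
    intro k
    simp_rw [mul_left_comm _ α]
    exact (integrableOn_pow_mul_exp_neg hβ k).const_mul α
  have hgmom : ∀ k : ℕ, ∫ x in Ioi (0 : ℝ), x ^ k * (α * Real.exp (-(β * x))) =
      α / β ^ (k + 1) * k.factorial := by
    intro k
    simp_rw [mul_left_comm _ α]
    rw [integral_const_mul, integral_pow_mul_exp_neg hβ]
    ring
  have hdiff : ∀ k : ℕ, ∫ x in Ioi (0 : ℝ), x ^ k * (F x - α * Real.exp (-(β * x))) =
      (a k - α / β ^ (k + 1)) * k.factorial := by
    intro k
    simp_rw [mul_sub]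
    rw [integral_sub (hint k) (hgint k), hmom, hgmom]
    ring
  have key := integral_pow_mul_nonneg_of_ordConnected (n := n)
    (h := fun x => F x - α * Real.exp (-(β * x)))
    (by simpa only [sub_pos] using hF.ordConnected_superlevel_exp hα0.le β)
    (fun k => by
      simp_rw [mul_sub]
      exact (hint k).sub (hgint k))
    (by
      rw [hdiff, hα]
      field_simp
      ring)
    (by
      rw [hdiff, hα, ← hβ2]
      field_simp
      ring)
  rw [hdiff] at key
  have hle : α / β ^ (n + 1 + 1) ≤ a (n + 1) :=
    sub_nonneg.1 (nonneg_of_mul_nonneg_left key (by positivity))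
  calc a n * a (n + 2) = (α / β ^ (n + 1 + 1)) ^ 2 := by
        rw [hα, ← hβ2]
        field_simp
        ring
    _ ≤ a (n + 1) ^ 2 := by gcongr

open ProbabilityTheory in
/-- The alternating Taylor coefficients of a Laplace transform are the normalized moments of the
exponentially tilted measures. -/
theorem altTaylorCoeff_laplace {φ : ℝ → ℝ} {μ : Measure ℝ} [IsFiniteMeasure μ]
    (hφ : ∀ t : ℝ, 0 ≤ t → φ t = ∫ x in Ici (0 : ℝ), Real.exp (-(t * x)) ∂μ) {t : ℝ} (ht : 0 < t)
    (n : ℕ) :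
    IntegrableOn (fun x => x ^ n * Real.exp (-(t * x))) (Ici 0) μ ∧
      altTaylorCoeff φ t n =
        (∫ x in Ici (0 : ℝ), x ^ n * Real.exp (-(t * x)) ∂μ) / n.factorial := by
  set ν := μ.restrict (Ici 0) with hν
  set X : ℝ → ℝ := fun x => -x with hX
  -- The Laplace transform is the moment generating function of `-x`. It is finite on `[0, ∞)`, so
  -- every `t > 0` is interior and differentiation under the integral is allowed.
  have hsub : Ici 0 ⊆ integrableExpSet X ν := by
    intro s hs
    refine Integrable.of_bound (C := 1) (by fun_prop) ?_
    filter_upwards [ae_restrict_mem measurableSet_Ici] with x hx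
    rw [Real.norm_eq_abs, Real.abs_exp, Real.exp_le_one_iff]
    simpa [hX] using mul_nonneg hs hx
  have hmem : t ∈ interior (integrableExpSet X ν) :=
    interior_mono hsub (by rwa [interior_Ici])
  have hsgn : ∀ x : ℝ, (-1) ^ n * (X x ^ n * Real.exp (t * X x)) = x ^ n * Real.exp (-(t * x)) := by
    intro x
    rw [← mul_assoc, ← mul_pow, hX]
    simp
  have heq : φ =ᶠ[𝓝 t] mgf X ν := by
    filter_upwards [Ioi_mem_nhds ht] with s hs
    rw [hφ s (le_of_lt hs), mgf]
    simp [hX]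
  constructor
  · rw [IntegrableOn, ← hν]
    simpa only [hsgn] using
      (integrable_pow_mul_exp_of_mem_interior_integrableExpSet hmem n).const_mul ((-1) ^ n)
  · rw [altTaylorCoeff, heq.iteratedDeriv_eq, iteratedDeriv_mgf hmem n, ← integral_const_mul]
    simp only [hsgn]

/-- This is the Dirac case. For `C, x > 0` the ratios of successive terms, `x / (n + 1)`, decrease;
for `x = 0` only the term of index `0` survives and the positivity criterion does not apply. -/
theorem isLogConcaveSeq_pow_div_factorial {C x : ℝ} (hC : 0 ≤ C) (hx : 0 ≤ x) :
    IsLogConcaveSeq fun n => C * x ^ n / n.factorial := by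
  rcases hC.eq_or_lt with rfl | hC
  · refine ⟨fun _ => by simp, fun m n k l hl hl' _ => ?_⟩
    simp [Real.zero_rpow hl.ne']
  rcases hx.eq_or_lt with rfl | hx
  · refine ⟨fun _ => by positivity, fun m n k l hl hl' hk => ?_⟩
    have h1l : 1 - l ≠ 0 := by linarith
    rcases eq_or_ne n 0 with rfl | hn
    · rcases eq_or_ne m 0 with rfl | hm
      · have : k = 0 := by
          have : (k : ℝ) = 0 := by rw [← hk]; simp
          exact_mod_cast this
        subst this
        simp only [pow_zero, mul_one, Nat.factorial_zero, Nat.cast_one, div_one]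
        rw [← Real.rpow_add hC, add_sub_cancel, Real.rpow_one]
      · simp only [zero_pow hm, mul_zero, zero_div, Real.zero_rpow h1l]
        positivity
    · simp only [zero_pow hn, mul_zero, zero_div, Real.zero_rpow hl.ne', zero_mul]
      positivity
  · refine isLogConcaveSeq_of_pos (fun n => by positivity) fun n => ?_
    have hf : (n.factorial : ℝ) ≠ 0 := by positivity
    have e1 : ((n + 2).factorial : ℝ) = (n + 2) * ((n + 1) * n.factorial) := by
      rw [Nat.factorial_succ, Nat.factorial_succ]
      push_cast
      ring
    have e2 : ((n + 1).factorial : ℝ) = (n + 1) * n.factorial := by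
      rw [Nat.factorial_succ]
      push_cast
      ring
    have hL : C * x ^ n / n.factorial * (C * x ^ (n + 2) / (n + 2).factorial) =
        (C * x ^ (n + 1) / (n + 1).factorial) ^ 2 * ((n + 1) / (n + 2)) := by
      rw [e1, e2]
      field_simp
      ring
    rw [hL]
    refine mul_le_of_le_one_right (sq_nonneg _) ?_
    rw [div_le_one (by positivity)]
    linarith

theorem isLogConcaveSeq_altTaylorCoeff_of_laplace {φ : ℝ → ℝ} {μ : Measure ℝ} [IsFiniteMeasure μ]
    (hμ : IsLogConcaveMeasureOnHalfLine μ)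
    (hφ : ∀ t : ℝ, 0 ≤ t → φ t = ∫ x in Ici (0 : ℝ), Real.exp (-(t * x)) ∂μ) {t : ℝ}
    (ht : 0 < t) : IsLogConcaveSeq (altTaylorCoeff φ t) := by
  rw [show altTaylorCoeff φ t = fun n : ℕ =>
    (∫ x in Ici (0 : ℝ), x ^ n * Real.exp (-(t * x)) ∂μ) / n.factorial from
    funext fun n => (altTaylorCoeff_laplace hφ ht n).2]
  have hi := fun n => (altTaylorCoeff_laplace hφ ht n).1
  rcases hμ with ⟨c, x₀, hx₀, rfl⟩ | ⟨f, hf, rfl⟩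
  · convert isLogConcaveSeq_pow_div_factorial (C := c * Real.exp (-(t * x₀))) (by positivity) hx₀
      using 3
    rw [Measure.restrict_smul, integral_smul_nnreal_measure, restrict_dirac' measurableSet_Ici,
      if_pos (mem_Ici.2 hx₀), integral_dirac, NNReal.smul_def, smul_eq_mul]
    ring
  · have hF : IsLogConcaveOn (Ioi 0) fun x => f x * Real.exp (-(t * x)) := by
      refine ⟨convex_Ioi 0, fun x hx => mul_nonneg (hf.2.1 x (Ioi_subset_Ici_self hx)) (Real.exp_pos _).le,
        fun x hx y hy l hl hl' => ?_⟩
      have h1 := hf.2.1 x (Ioi_subset_Ici_self hx)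
      have h2 := hf.2.1 y (Ioi_subset_Ici_self hy)
      rw [Real.mul_rpow h1 (Real.exp_pos _).le, Real.mul_rpow h2 (Real.exp_pos _).le,
        ← Real.exp_mul, ← Real.exp_mul, mul_mul_mul_comm, ← Real.exp_add]
      have h3 := hf.2.2 x (Ioi_subset_Ici_self hx) y (Ioi_subset_Ici_self hy) l hl hl'
      rw [show -(t * x) * l + -(t * y) * (1 - l) = -(t * (l • x + (1 - l) • y)) by
        simp only [smul_eq_mul]; ring]
      exact mul_le_mul_of_nonneg_right h3 (Real.exp_pos _).le
    have hm := hf.aemeasurable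
    have hnn : ∀ᵐ x ∂volume.restrict (Ici (0 : ℝ)), 0 ≤ f x :=
      (ae_restrict_iff' measurableSet_Ici).2 (ae_of_all _ hf.2.1)
    have hres : ((volume.restrict (Ici (0 : ℝ))).withDensity
        (fun x => ENNReal.ofReal (f x))).restrict (Ici 0) =
        (volume.restrict (Ici (0 : ℝ))).withDensity (fun x => ENNReal.ofReal (f x)) := by
      rw [restrict_withDensity measurableSet_Ici, Measure.restrict_restrict measurableSet_Ici,
        inter_self]
    simp only [IntegrableOn, hres] at hi
    rw [hres]
    have hinteg : ∀ n : ℕ, Integrable (fun x => x ^ n * (f x * Real.exp (-(t * x))))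
        (volume.restrict (Ici (0 : ℝ))) := by
      intro n
      have := hi n
      simp only [ENNReal.ofReal] at this
      rw [integrable_withDensity_iff_integrable_coe_smul₀ hm.real_toNNReal] at this
      refine this.congr ?_
      filter_upwards [hnn] with x hx
      rw [Real.coe_toNNReal _ hx, smul_eq_mul]
      ring
    convert hF.isLogConcaveSeq_moments fun k => (hinteg k).mono_measure
      (Measure.restrict_mono Ioi_subset_Ici_self le_rfl) using 3
    simp only [ENNReal.ofReal]
    rw [integral_withDensity_eq_integral_smul₀ hm.real_toNNReal, integral_Ici_eq_integral_Ioi]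
    refine setIntegral_congr_fun measurableSet_Ioi fun x hx => ?_
    simp only [NNReal.smul_def]
    rw [Real.coe_toNNReal _ (hf.2.1 x (Ioi_subset_Ici_self hx)), smul_eq_mul]
    ring
end

/-! ### Lattice measures, transported to the unit interval by `y = e^{-x}`. -/

section
open Filter Topology ENNReal unitInterval

/-- The points of the unit interval whose negative logarithm is at distance at most `h` of `x`. -/
def negLogBall (x h : ℝ) : Set I :=
  {y | Real.exp (-(x + h)) ≤ (y : ℝ) ∧ (y : ℝ) ≤ Real.exp (-(x - h))}

theorem isClosed_negLogBall (x h : ℝ) : IsClosed (negLogBall x h) :=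
  (isClosed_le continuous_const continuous_subtype_val).inter
    (isClosed_le continuous_subtype_val continuous_const)

theorem exists_isOpen_negLogBall_subset (x : ℝ) {h h' : ℝ} (hh : h < h') :
    ∃ G : Set I, IsOpen G ∧ negLogBall x h ⊆ G ∧ G ⊆ negLogBall x h' := by
  refine ⟨{y | Real.exp (-(x + h')) < (y : ℝ) ∧ (y : ℝ) < Real.exp (-(x - h'))},
    (isOpen_lt continuous_const continuous_subtype_val).inter
      (isOpen_lt continuous_subtype_val continuous_const), fun y hy => ⟨?_, ?_⟩,
    fun y hy => ⟨hy.1.le, hy.2.le⟩⟩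
  · exact lt_of_lt_of_le (Real.exp_lt_exp.2 (by linarith)) hy.1
  · exact lt_of_le_of_lt hy.2 (Real.exp_lt_exp.2 (by linarith))

theorem negLogBall_mono (x : ℝ) {h h' : ℝ} (hh : h ≤ h') : negLogBall x h ⊆ negLogBall x h' :=
  fun _ hy => ⟨(Real.exp_le_exp.2 (by linarith)).trans hy.1,
    hy.2.trans (Real.exp_le_exp.2 (by linarith))⟩

/-- The point of the unit interval with negative logarithm `n / t`. -/
noncomputable def expLatticePoint (t : ℝ≥0) (n : ℕ) : I :=
  ⟨Real.exp (-(n / t)), (Real.exp_pos _).le, Real.exp_le_one_iff.2 (by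
    rw [neg_nonpos]; positivity)⟩

/-- The measure `∑ n, w n • δ_{exp (-n / t)}` on the unit interval. -/
noncomputable def expLatticeMeasure (w : ℕ → ℝ) (t : ℝ≥0) : Measure I :=
  Measure.sum fun n => ENNReal.ofReal (w n) • Measure.dirac (expLatticePoint t n)

theorem expLatticePoint_mem_negLogBall {t : ℝ≥0} (ht : 0 < t) (n : ℕ) (x h : ℝ) :
    expLatticePoint t n ∈ negLogBall x h ↔ t * (x - h) ≤ n ∧ (n : ℝ) ≤ t * (x + h) := by
  have ht' : (0 : ℝ) < t := ht
  simp only [expLatticePoint, negLogBall, mem_ofPred_eq, Real.exp_le_exp, neg_le_neg_iff]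
  rw [div_le_iff₀ ht', le_div_iff₀ ht', mul_comm (x + h), mul_comm (x - h)]
  exact and_comm

-- Summing over `ℤ` lets windows of indices begin below `0`, as they do when `x < h`.
open Classical in
theorem expLatticeMeasure_negLogBall (w : ℕ → ℝ) {t : ℝ≥0} (ht : 0 < t) (x h : ℝ) :
    expLatticeMeasure w t (negLogBall x h) = ∑' n : ℤ,
      if t * (x - h) ≤ n ∧ (n : ℝ) ≤ t * (x + h) then ENNReal.ofReal (extendInt w n) else 0 := by
  rw [expLatticeMeasure, Measure.sum_apply _ (isClosed_negLogBall x h).measurableSet,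
    ← (Nat.cast_injective (R := ℤ)).tsum_eq]
  · refine tsum_congr fun n => ?_
    rw [Measure.smul_apply, Measure.dirac_apply' _ (isClosed_negLogBall x h).measurableSet,
      smul_eq_mul, indicator_apply, expLatticePoint_mem_negLogBall ht]
    simp
  · intro n hn
    by_contra hn'
    refine hn ?_
    have : n < 0 := by
      by_contra hneg
      exact hn' ⟨n.toNat, Int.toNat_of_nonneg (not_lt.1 hneg)⟩
    simp [extendInt_of_neg w this]

theorem expLatticeMeasure_negLogBall_le {w : ℕ → ℝ} (hw : ∀ n, 0 ≤ extendInt w n) {t : ℝ≥0}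
    (ht : 0 < t) {x h : ℝ} {p : ℤ} {N : ℕ}
    (H : ∀ n : ℤ, t * (x - h) ≤ n → (n : ℝ) ≤ t * (x + h) → p ≤ n ∧ n < p + N) :
    expLatticeMeasure w t (negLogBall x h) ≤
      ENNReal.ofReal (∑ i ∈ Finset.range N, extendInt w (p + i)) := by
  classical
  rw [expLatticeMeasure_negLogBall w ht, ENNReal.ofReal_sum_of_nonneg fun i _ => hw _]
  let e : ℕ ↪ ℤ := ⟨fun i => p + i, fun i j hij => by simpa using hij⟩
  rw [tsum_eq_sum (s := (Finset.range N).map e), Finset.sum_map]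
  · refine Finset.sum_le_sum fun i _ => ?_
    split_ifs
    exacts [le_rfl, zero_le]
  · intro n hn
    refine if_neg fun hn' => hn ?_
    obtain ⟨h1, h2⟩ := H n hn'.1 hn'.2
    refine Finset.mem_map.2 ⟨(n - p).toNat, Finset.mem_range.2 (by lia), ?_⟩
    change p + ((n - p).toNat : ℤ) = n
    lia

theorem le_expLatticeMeasure_negLogBall {w : ℕ → ℝ} (hw : ∀ n, 0 ≤ extendInt w n) {t : ℝ≥0}
    (ht : 0 < t) {x h : ℝ} {p : ℤ} {N : ℕ}
    (H : ∀ n : ℤ, p ≤ n → n < p + N → t * (x - h) ≤ n ∧ (n : ℝ) ≤ t * (x + h)) :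
    ENNReal.ofReal (∑ i ∈ Finset.range N, extendInt w (p + i)) ≤
      expLatticeMeasure w t (negLogBall x h) := by
  classical
  rw [expLatticeMeasure_negLogBall w ht, ENNReal.ofReal_sum_of_nonneg fun i _ => hw _]
  let e : ℕ ↪ ℤ := ⟨fun i => p + i, fun i j hij => by simpa using hij⟩
  refine le_trans ?_ (ENNReal.sum_le_tsum ((Finset.range N).map e))
  rw [Finset.sum_map]
  refine Finset.sum_le_sum fun i hi => ?_
  have := Finset.mem_range.1 hi
  have h1 := H (p + i) (by lia) (by lia)
  change _ ≤ if t * (x - h) ≤ ((p + i : ℤ) : ℝ) ∧ ((p + i : ℤ) : ℝ) ≤ t * (x + h) then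
    ENNReal.ofReal (extendInt w (p + i)) else 0
  rw [if_pos h1]

/-- The lattice measure of a Pólya frequency sequence is log-concave on balls up to the mesh of the
lattice. -/
theorem expLatticeMeasure_rpow_mul_le {w : ℕ → ℝ} (hw : IsPolyaFreqSeq (extendInt w)) {t : ℝ≥0}
    (ht : 0 < t) {x y h l ε : ℝ} (hh : 0 < h) (hl : 0 < l) (hl' : l < 1) (hε : 2 ≤ t * ε) :
    expLatticeMeasure w t (negLogBall x h) ^ l * expLatticeMeasure w t (negLogBall y h) ^ (1 - l) ≤
      expLatticeMeasure w t (negLogBall (l * x + (1 - l) * y) (h + ε)) := by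
  have h1l : 0 < 1 - l := by linarith
  have ht' : (0 : ℝ) < t := ht
  -- One window length for all balls of radius `h`: `N > 2 * h * t` covers every lattice point of
  -- the ball, and `N ≤ 2 * h * t + 1` keeps the window inside a slightly larger ball.
  set N : ℕ := ⌊2 * h * t⌋₊ + 1 with hN
  have hN1 : 2 * h * t < N := by
    rw [hN]; push_cast; exact Nat.lt_floor_add_one _
  have hN2 : (N : ℝ) ≤ 2 * h * t + 1 := by
    rw [hN]; push_cast; linarith [Nat.floor_le (show 0 ≤ 2 * h * t by positivity)]
  set W : ℤ → ℝ := fun p => ∑ i ∈ Finset.range N, extendInt w (p + i) with hW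
  have hWpf : IsPolyaFreqSeq W := hw.sum_window N
  have upper : ∀ x : ℝ, expLatticeMeasure w t (negLogBall x h) ≤
      ENNReal.ofReal (W ⌈t * (x - h)⌉) := by
    intro x
    refine expLatticeMeasure_negLogBall_le hw.nonneg ht fun n h1 h2 => ⟨Int.ceil_le.2 h1, ?_⟩
    have h3 := Int.le_ceil ((t : ℝ) * (x - h))
    have : (n : ℝ) < (⌈(t : ℝ) * (x - h)⌉ + N : ℤ) := by push_cast; linarith
    exact Int.cast_lt.1 this
  set m := ⌈t * (x - h)⌉ with hm
  set m' := ⌈t * (y - h)⌉ with hm'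
  set κ : ℝ := l * m + (1 - l) * m' with hκ
  have hκ1 : t * (l * x + (1 - l) * y - h) ≤ κ := by
    have h1 := mul_le_mul_of_nonneg_left (Int.le_ceil ((t : ℝ) * (x - h))) hl.le
    have h2 := mul_le_mul_of_nonneg_left (Int.le_ceil ((t : ℝ) * (y - h))) h1l.le
    rw [hκ]
    linarith
  have hκ2 : κ ≤ t * (l * x + (1 - l) * y - h) + 1 := by
    have h1 := mul_le_mul_of_nonneg_left (Int.ceil_lt_add_one ((t : ℝ) * (x - h))).le hl.le
    have h2 := mul_le_mul_of_nonneg_left (Int.ceil_lt_add_one ((t : ℝ) * (y - h))).le h1l.le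
    rw [hκ]
    linarith
  have hk1 := Int.floor_le κ
  have hk2 := Int.lt_floor_add_one κ
  have hmax := (hWpf.rpow_mul_rpow_le_max hl hl' hk1 hk2).1
  -- The upper end overshoots by at most `2`: one from the ceilings in `κ`, one from rounding `κ`.
  -- This is the `2` in `hε`.
  have lower : ∀ p : ℤ, (p : ℝ) ≤ κ + 1 → κ - 1 ≤ p →
      ENNReal.ofReal (W p) ≤
        expLatticeMeasure w t (negLogBall (l * x + (1 - l) * y) (h + ε)) := by
    intro p hp1 hp2
    refine le_expLatticeMeasure_negLogBall hw.nonneg ht fun n h1 h2 => ?_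
    have h3 : (p : ℝ) ≤ n := Int.cast_le.2 h1
    have h4 : (n : ℝ) + 1 ≤ p + N := by exact_mod_cast h2
    constructor <;> linarith
  calc _ ≤ ENNReal.ofReal (W m) ^ l * ENNReal.ofReal (W m') ^ (1 - l) := by
        gcongr
        · exact upper x
        · exact upper y
    _ = ENNReal.ofReal (W m ^ l * W m' ^ (1 - l)) := by
        rw [ENNReal.ofReal_rpow_of_nonneg (hWpf.nonneg _) hl.le,
          ENNReal.ofReal_rpow_of_nonneg (hWpf.nonneg _) h1l.le, ENNReal.ofReal_mul]
        exact Real.rpow_nonneg (hWpf.nonneg _) _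
    _ ≤ ENNReal.ofReal (max (W ⌊κ⌋) (W (⌊κ⌋ + 1))) := ENNReal.ofReal_le_ofReal hmax
    _ ≤ _ := by
        rcases max_choice (W ⌊κ⌋) (W (⌊κ⌋ + 1)) with h | h <;> rw [h]
        · exact lower _ (by linarith) (by linarith)
        · exact lower _ (by push_cast; linarith) (by push_cast; linarith)

end

/-! ### The limit of the lattice measures: from (i) to (ii). -/

section
open Filter Topology ENNReal unitInterval

theorem integral_expLatticeMeasure {w : ℕ → ℝ} (hw : ∀ n, 0 ≤ w n) (t : ℝ≥0)
    [IsFiniteMeasure (expLatticeMeasure w t)] (g : C(I, ℝ)) :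
    HasSum (fun n => w n * g (expLatticePoint t n)) (∫ y, g y ∂expLatticeMeasure w t) := by
  have hint : Integrable g (expLatticeMeasure w t) :=
    g.continuous.integrable_of_hasCompactSupport (HasCompactSupport.of_compactSpace _)
  refine (hasSum_integral_measure hint).congr_fun fun n => ?_
  rw [integral_smul_measure, integral_dirac, ENNReal.toReal_ofReal (hw n), smul_eq_mul]

/-- A thickened indicator is a continuous function squeezed between the indicators of `K` and `G`,
and its integrals converge. -/
theorem measure_le_liminf_of_isCompact {Ω ι : Type*} {L : Filter ι}
    [MeasurableSpace Ω] [PseudoMetricSpace Ω] [OpensMeasurableSpace Ω] {μ : FiniteMeasure Ω}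
    {μs : ι → FiniteMeasure Ω} (hlim : Tendsto μs L (𝓝 μ)) [L.NeBot] {K G : Set Ω}
    (hK : IsCompact K) (hG : IsOpen G) (hKG : K ⊆ G) :
    (μ : Measure Ω) K ≤ liminf (fun i => (μs i : Measure Ω) G) L := by
  obtain ⟨δ, hδ, hδG⟩ := hK.exists_thickening_subset_open hG hKG
  have h := FiniteMeasure.tendsto_iff_forall_lintegral_tendsto.1 hlim (thickenedIndicator hδ K)
  calc (μ : Measure Ω) K ≤ (μ : Measure Ω) (closure K) := measure_mono subset_closure
    _ = ∫⁻ y, (closure K).indicator 1 y ∂μ := by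
        rw [lintegral_indicator_one isClosed_closure.measurableSet]
    _ ≤ ∫⁻ y, thickenedIndicator hδ K y ∂μ := by
        refine lintegral_mono fun y => ?_
        by_cases hy : y ∈ closure K
        · simp [hy, thickenedIndicator_one_of_mem_closure hδ K hy]
        · simp [hy]
    _ = liminf (fun i => ∫⁻ y, thickenedIndicator hδ K y ∂(μs i)) L := h.liminf_eq.symm
    _ ≤ liminf (fun i => (μs i : Measure Ω) G) L := by
        refine liminf_le_liminf (Eventually.of_forall fun i => ?_)
        rw [← lintegral_indicator_one hG.measurableSet]
        refine lintegral_mono fun y => ?_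
        by_cases hy : y ∈ G
        · simpa [hy] using thickenedIndicator_le_one hδ K y
        · simp [hy, thickenedIndicator_zero hδ K fun hy' => hy (hδG hy')]

theorem negLogBall_rpow_mul_le_of_tendsto {ι : Type*} {L : Filter ι} [L.NeBot]
    {ν : FiniteMeasure I} {νs : ι → FiniteMeasure I} (hlim : Tendsto νs L (𝓝 ν))
    (H : ∀ x y h l ε : ℝ, 0 < h → 0 < l → l < 1 → 0 < ε → ∀ᶠ i in L,
      (νs i : Measure I) (negLogBall x h) ^ l * (νs i : Measure I) (negLogBall y h) ^ (1 - l) ≤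
        (νs i : Measure I) (negLogBall (l * x + (1 - l) * y) (h + ε)))
    {x y h l : ℝ} (hh : 0 < h) (hl : 0 < l) (hl' : l < 1) :
    (ν : Measure I) (negLogBall x h) ^ l * (ν : Measure I) (negLogBall y h) ^ (1 - l) ≤
      (ν : Measure I) (negLogBall (l * x + (1 - l) * y) h) := by
  have h1l : 0 < 1 - l := by linarith
  set z := l * x + (1 - l) * y
  have hinter : ⋂ r > h, negLogBall z r = negLogBall z h := by
    refine Subset.antisymm (fun u hu => ?_) (subset_iInter₂ fun r hr => negLogBall_mono z hr.le)
    simp only [mem_iInter] at hu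
    have hu' : ∀ᶠ r in 𝓝[>] h, u ∈ negLogBall z r := by
      filter_upwards [self_mem_nhdsWithin] with r hr using hu r hr
    have hc1 : Tendsto (fun r => Real.exp (-(z + r))) (𝓝[>] h) (𝓝 (Real.exp (-(z + h)))) :=
      tendsto_nhdsWithin_of_tendsto_nhds (Continuous.tendsto (by fun_prop) h)
    have hc2 : Tendsto (fun r => Real.exp (-(z - r))) (𝓝[>] h) (𝓝 (Real.exp (-(z - h)))) :=
      tendsto_nhdsWithin_of_tendsto_nhds (Continuous.tendsto (by fun_prop) h)
    exact ⟨le_of_tendsto hc1 (hu'.mono fun r hr => hr.1),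
      ge_of_tendsto hc2 (hu'.mono fun r hr => hr.2)⟩
  have hmeas := tendsto_measure_biInter_gt (μ := (ν : Measure I)) (s := negLogBall z) (a := h)
    (fun r _ => (isClosed_negLogBall z r).measurableSet.nullMeasurableSet)
    (fun i j _ hij => negLogBall_mono z hij) ⟨h + 1, by linarith, measure_ne_top _ _⟩
  rw [hinter] at hmeas
  refine ge_of_tendsto hmeas ?_
  filter_upwards [self_mem_nhdsWithin] with r hr
  have hr : h < r := hr
  -- Half of the extra radius goes into fitting an open set around the compact ball, half into the
  -- mesh error; then `r` decreases to `h`.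
  set ε := (r - h) / 2 with hε
  have hε0 : 0 < ε := by rw [hε]; linarith
  have lower : ∀ x, (ν : Measure I) (negLogBall x h) ≤
      liminf (fun i => (νs i : Measure I) (negLogBall x (h + ε))) L := by
    intro x
    obtain ⟨G, hG, hG1, hG2⟩ := exists_isOpen_negLogBall_subset x (show h < h + ε by linarith)
    refine (measure_le_liminf_of_isCompact hlim (isClosed_negLogBall x h).isCompact hG
      hG1).trans (liminf_le_liminf (Eventually.of_forall fun i => measure_mono hG2))
  have hliminf : ∀ (u : ι → ℝ≥0∞) (p : ℝ), 0 < p →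
      (liminf u L) ^ p = liminf (fun h => u h ^ p) L := fun u p hp =>
    (ENNReal.orderIsoRpow p hp).liminf_apply
  calc _ ≤ liminf (fun i => (νs i : Measure I) (negLogBall x (h + ε))) L ^ l *
          liminf (fun i => (νs i : Measure I) (negLogBall y (h + ε))) L ^ (1 - l) := by
        gcongr
        · exact lower x
        · exact lower y
    _ ≤ liminf (fun i => (νs i : Measure I) (negLogBall z r)) L := by
        rw [hliminf _ l hl, hliminf _ _ h1l]
        refine ENNReal.le_liminf_mul.trans (liminf_le_liminf ?_)
        have := H x y (h + ε) l ε (by linarith) hl hl' hε0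
        rwa [show h + ε + ε = r by rw [hε]; ring] at this
    _ ≤ limsup (fun i => (νs i : Measure I) (negLogBall z r)) L := liminf_le_limsup
    _ ≤ _ := FiniteMeasure.limsup_measure_closed_le_of_tendsto hlim (isClosed_negLogBall z r)

theorem tendsto_mul_one_sub_exp_neg_div (u : ℝ) :
    Tendsto (fun t : ℝ => t * (1 - Real.exp (-(u / t)))) atTop (𝓝 u) := by
  have h : HasDerivAt (fun s : ℝ => 1 - Real.exp (-(u * s))) u 0 := by
    have h1 : HasDerivAt (fun s : ℝ => -(u * s)) (-u) 0 := by
      simpa using ((hasDerivAt_id' (0 : ℝ)).const_mul u).fun_neg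
    simpa using h1.exp.const_sub 1
  have h2 := (hasDerivAt_iff_tendsto_slope.1 h).comp
    (tendsto_inv_atTop_nhdsGT_zero.mono_right
    (nhdsWithin_mono _ fun x (hx : 0 < x) => hx.ne'))
  refine h2.congr' ?_
  filter_upwards [eventually_gt_atTop 0] with t ht
  simp [slope_def_field, div_eq_mul_inv, mul_comm]

/-- Partial Taylor sums at `s` are at most `φ s`; let `s → 0`. This bounds the masses of the lattice
measures uniformly in `t`. -/
theorem sum_altTaylorCoeff_le {φ : ℝ → ℝ} (hcont : ContinuousOn φ (Ici 0))
    (hsmooth : ContDiffOn ℝ (⊤ : ℕ∞) φ (Ioi 0))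
    (hnn : ∀ t, 0 < t → ∀ n, 0 ≤ altTaylorCoeff φ t n) {t : ℝ} (ht : 0 < t) (N : ℕ) :
    ∑ n ∈ Finset.range N, t ^ n * altTaylorCoeff φ t n ≤ φ 0 := by
  have h1 : Tendsto φ (𝓝[>] 0) (𝓝 (φ 0)) :=
    ((hcont 0 self_mem_Ici).mono Ioi_subset_Ici_self).tendsto
  have h2 : Tendsto (fun s => ∑ n ∈ Finset.range N, altTaylorCoeff φ t n * (t - s) ^ n) (𝓝[>] 0)
      (𝓝 (∑ n ∈ Finset.range N, altTaylorCoeff φ t n * (t - 0) ^ n)) :=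
    tendsto_nhdsWithin_of_tendsto_nhds (Continuous.tendsto (by fun_prop) 0)
  simp only [sub_zero, mul_comm (altTaylorCoeff φ t _)] at h2
  refine le_of_tendsto_of_tendsto h2 h1 ?_
  filter_upwards [Ioo_mem_nhdsGT ht] with s hs
  have hsum := hasSum_altTaylorCoeff hsmooth hnn hs.1 hs.2.le
  simp only [mul_comm _ (altTaylorCoeff φ t _)]
  exact sum_le_hasSum _ (fun n _ => mul_nonneg (hnn t ht n) (pow_nonneg (by linarith [hs.2]) n)) hsum

/-- The function `y ↦ y ^ u` on the unit interval. -/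
noncomputable def rpowUnitInterval (u : ℝ) (hu : 0 < u) : C(I, ℝ) :=
  ⟨fun y => (y : ℝ) ^ u, continuous_subtype_val.rpow_const fun _ => Or.inr hu.le⟩

theorem exists_lattice_approximation {φ : ℝ → ℝ} (hcont : ContinuousOn φ (Ici 0))
    (hsmooth : ContDiffOn ℝ (⊤ : ℕ∞) φ (Ioi 0))
    (hlc : ∀ t : ℝ, 0 < t → IsLogConcaveSeq (altTaylorCoeff φ t)) {t : ℝ≥0} (ht : 0 < t) :
    ∃ ν : FiniteMeasure I, ν.mass ≤ (φ 0).toNNReal ∧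
      (∀ (u : ℝ) (hu : 0 < u),
        ∫ y, rpowUnitInterval u hu y ∂(ν : Measure I) = φ (t * (1 - Real.exp (-(u / t))))) ∧
      ∀ x y h l ε : ℝ, 0 < h → 0 < l → l < 1 → 2 ≤ t * ε →
        (ν : Measure I) (negLogBall x h) ^ l * (ν : Measure I) (negLogBall y h) ^ (1 - l) ≤
          (ν : Measure I) (negLogBall (l * x + (1 - l) * y) (h + ε)) := by
  have ht' : (0 : ℝ) < t := ht
  have hnn : ∀ t, 0 < t → ∀ n, 0 ≤ altTaylorCoeff φ t n := fun t ht => (hlc t ht).1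
  set w : ℕ → ℝ := fun n => (t : ℝ) ^ n * altTaylorCoeff φ t n with hw
  have hw0 : ∀ n, 0 ≤ w n := fun n => mul_nonneg (by positivity) (hnn t ht' n)
  have hpf : IsPolyaFreqSeq (extendInt w) := by
    refine isPolyaFreqSeq_extendInt hw0 fun p q hpq => ?_
    have := mul_le_mul_of_nonneg_left ((hlc t ht').mul_le hpq)
      (show 0 ≤ (t : ℝ) ^ (p + q + 2) by positivity)
    calc w p * w (q + 2) = _ := by simp only [hw]; ring
      _ ≤ _ := this
      _ = w (p + 1) * w (q + 1) := by simp only [hw]; ring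
  have hmass : expLatticeMeasure w t univ ≤ ENNReal.ofReal (φ 0) := by
    rw [expLatticeMeasure, Measure.sum_apply _ MeasurableSet.univ]
    simp only [Measure.smul_apply, measure_univ, smul_eq_mul, mul_one]
    refine ENNReal.tsum_le_of_sum_range_le fun N => ?_
    rw [← ENNReal.ofReal_sum_of_nonneg fun n _ => hw0 n]
    exact ENNReal.ofReal_le_ofReal (sum_altTaylorCoeff_le hcont hsmooth hnn ht' N)
  have hfin : IsFiniteMeasure (expLatticeMeasure w t) := ⟨hmass.trans_lt ENNReal.ofReal_lt_top⟩
  refine ⟨⟨expLatticeMeasure w t, hfin⟩, ENNReal.coe_le_coe.1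
    (FiniteMeasure.ennreal_mass.trans_le hmass), fun u hu => ?_, ?_⟩
  · refine (integral_expLatticeMeasure hw0 t (rpowUnitInterval u hu)).unique ?_
    have hr0 : Real.exp (-(u / t)) < 1 := by
      rw [Real.exp_lt_one_iff]
      have : 0 < u / t := by positivity
      linarith
    have hr1 := Real.exp_pos (-(u / t))
    have := hasSum_altTaylorCoeff hsmooth hnn (s := t * (1 - Real.exp (-(u / t)))) (t := t)
      (mul_pos ht' (by linarith)) (mul_le_of_le_one_right ht'.le (by linarith))
    refine this.congr_fun fun n => ?_
    change (t : ℝ) ^ n * altTaylorCoeff φ t n * Real.exp (-(n / t)) ^ u = _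
    have e : (t : ℝ) - t * (1 - Real.exp (-(u / t))) = t * Real.exp (-(u / t)) := by ring
    rw [e, mul_pow, ← Real.exp_mul, ← Real.exp_nat_mul]
    ring_nf
  · exact fun x y h l ε hh hl hl' hε => expLatticeMeasure_rpow_mul_le hpf ht hh hl hl' hε

/-- Measures of mass at most `φ 0` on the compact interval form a compact set, so the approximations
for `t = n + 1` converge along an ultrafilter. -/
theorem exists_measure_unitInterval {φ : ℝ → ℝ} (hcont : ContinuousOn φ (Ici 0))
    (hsmooth : ContDiffOn ℝ (⊤ : ℕ∞) φ (Ioi 0))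
    (hlc : ∀ t : ℝ, 0 < t → IsLogConcaveSeq (altTaylorCoeff φ t)) :
    ∃ ν : FiniteMeasure I,
      (∀ (u : ℝ) (hu : 0 < u), ∫ y, rpowUnitInterval u hu y ∂(ν : Measure I) = φ u) ∧
      ∀ x y h l : ℝ, 0 < h → 0 < l → l < 1 →
        (ν : Measure I) (negLogBall x h) ^ l * (ν : Measure I) (negLogBall y h) ^ (1 - l) ≤
          (ν : Measure I) (negLogBall (l * x + (1 - l) * y) h) := by
  choose νs hmass hint hball using fun n : ℕ =>
    exists_lattice_approximation hcont hsmooth hlc (t := n + 1) (by positivity)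
  let U : Ultrafilter ℕ := hyperfilter ℕ
  have hU : (U : Filter ℕ) ≤ atTop := Nat.hyperfilter_le_atTop
  obtain ⟨ν, -, hν⟩ := (isCompact_setOfPred_finiteMeasure_le_of_compactSpace I
    (φ 0).toNNReal).ultrafilter_le_nhds (U.map νs) (by
      rw [le_principal_iff]
      exact Filter.mem_map.2 (univ_mem' hmass))
  have hlim : Tendsto νs U (𝓝 ν) := hν
  have hcast : Tendsto (fun n : ℕ => ((n + 1 : ℝ≥0) : ℝ)) U atTop := by
    refine Tendsto.mono_left ?_ hU
    push_cast
    exact tendsto_atTop_add_const_right _ _ tendsto_natCast_atTop_atTop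
  refine ⟨ν, fun u hu => ?_, fun x y h l hh hl hl' =>
    negLogBall_rpow_mul_le_of_tendsto hlim (fun x y h l ε hh hl hl' hε => ?_) hh hl hl'⟩
  · have h1 := FiniteMeasure.tendsto_iff_forall_integral_tendsto.1 hlim
      (BoundedContinuousFunction.mkOfCompact (rpowUnitInterval u hu))
    have h2 : Tendsto (fun n : ℕ => φ ((n + 1 : ℝ≥0) * (1 - Real.exp (-(u / (n + 1 : ℝ≥0)))))) U
        (𝓝 (φ u)) :=
      ((hcont.continuousAt (Ici_mem_nhds hu)).tendsto.comp
        (tendsto_mul_one_sub_exp_neg_div u)).comp hcast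
    refine tendsto_nhds_unique h1 (h2.congr fun n => ?_)
    exact (hint n u hu).symm
  · filter_upwards [hcast.eventually_ge_atTop (2 / ε)] with n hn
    refine hball n x y h l ε hh hl hl' ?_
    rwa [div_le_iff₀ hε] at hn

theorem exists_logConcaveMeasure {φ : ℝ → ℝ} (hcont : ContinuousOn φ (Ici 0))
    (hsmooth : ContDiffOn ℝ (⊤ : ℕ∞) φ (Ioi 0))
    (hlc : ∀ t : ℝ, 0 < t → IsLogConcaveSeq (altTaylorCoeff φ t)) :
    ∃ μ : Measure ℝ, IsFiniteMeasure μ ∧ IsLogConcaveMeasureOnHalfLine μ ∧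
      ∀ t : ℝ, 0 ≤ t → φ t = ∫ x in Ici (0 : ℝ), Real.exp (-(t * x)) ∂μ := by
  obtain ⟨ν, hint, hball⟩ := exists_measure_unitInterval hcont hsmooth hlc
  -- The point `y = 0` stands for `x = ∞`. Discarding it changes neither the balls nor the integrals
  -- of `y ^ u` with `u > 0`.
  set S : Set I := {y | 0 < (y : ℝ)} with hS
  have hSm : MeasurableSet S := measurableSet_lt measurable_const measurable_subtype_coe
  set L : I → ℝ := fun y => -Real.log y with hL
  have hLm : Measurable L := (Real.measurable_log.comp measurable_subtype_coe).neg
  set μ : Measure ℝ := ((ν : Measure I).restrict S).map L with hμ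
  have hfin : IsFiniteMeasure μ := inferInstance
  have hμball : ∀ x h, μ (Metric.closedBall x h) = (ν : Measure I) (negLogBall x h) := by
    intro x h
    rw [hμ, Measure.map_apply hLm measurableSet_closedBall,
      Measure.restrict_apply (hLm measurableSet_closedBall)]
    congr 1
    ext y
    simp only [mem_inter_iff, mem_preimage, Real.closedBall_eq_Icc, mem_Icc, hL, hS, mem_ofPred_eq,
      negLogBall]
    constructor
    · rintro ⟨⟨h1, h2⟩, hy⟩
      exact ⟨(Real.le_log_iff_exp_le hy).1 (by linarith), (Real.log_le_iff_le_exp hy).1 (by linarith)⟩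
    · rintro ⟨h1, h2⟩
      have hy : 0 < (y : ℝ) := (Real.exp_pos _).trans_le h1
      have h3 := (Real.le_log_iff_exp_le hy).2 h1
      have h4 := (Real.log_le_iff_le_exp hy).2 h2
      exact ⟨⟨by linarith, by linarith⟩, hy⟩
  have hlcb : LogConcaveOnBalls μ := by
    intro x y h l hh hl hl'
    simp only [hμball]
    exact hball x y h l hh hl hl'
  have hIio : μ (Iio 0) = 0 := by
    rw [hμ, Measure.map_apply hLm measurableSet_Iio]
    have : L ⁻¹' Iio 0 = ∅ := by
      ext y
      simpa [hL] using Real.log_nonpos y.2.1 y.2.2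
    simp [this]
  have hres : μ.restrict (Ici 0) = μ := Measure.restrict_eq_self_of_ae_mem
    (by rw [ae_iff]; simpa [Iio_def] using hIio)
  have hpos : ∀ u : ℝ, 0 < u → φ u = ∫ x in Ici (0 : ℝ), Real.exp (-(u * x)) ∂μ := by
    intro u hu
    rw [hres, hμ, integral_map hLm.aemeasurable (by fun_prop), ← hint u hu,
      ← setIntegral_eq_integral_of_forall_compl_eq_zero (s := S)]
    · refine setIntegral_congr_fun hSm fun y hy => ?_
      change (y : ℝ) ^ u = Real.exp (-(u * -Real.log y))
      rw [Real.rpow_def_of_pos hy]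
      ring_nf
    · intro y hy
      have : (y : ℝ) = 0 := le_antisymm (not_lt.1 hy) y.2.1
      change (y : ℝ) ^ u = 0
      rw [this, Real.zero_rpow hu.ne']
  refine ⟨μ, hfin, hlcb.isLogConcaveMeasureOnHalfLine hIio, fun u hu => ?_⟩
  rcases hu.eq_or_lt with rfl | hu
  -- The discarded point could matter for `u = 0`, so the identity is obtained there by right
  -- continuity of both sides.
  · have h1 : Tendsto φ (𝓝[>] 0) (𝓝 (φ 0)) :=
      ((hcont 0 self_mem_Ici).mono Ioi_subset_Ici_self).tendsto
    have h2 : Tendsto (fun u : ℝ => ∫ x in Ici (0 : ℝ), Real.exp (-(u * x)) ∂μ) (𝓝[>] 0)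
        (𝓝 (∫ x in Ici (0 : ℝ), Real.exp (-(0 * x)) ∂μ)) := by
      refine tendsto_integral_filter_of_dominated_convergence (fun _ => 1)
        (Eventually.of_forall fun u => by fun_prop) ?_ (integrable_const _)
        (ae_of_all _ fun x => tendsto_nhdsWithin_of_tendsto_nhds
          (Continuous.tendsto (f := fun u : ℝ => Real.exp (-(u * x))) (by fun_prop) 0))
      filter_upwards [self_mem_nhdsWithin] with u hu
      filter_upwards [ae_restrict_mem measurableSet_Ici] with x hx
      rw [Real.norm_eq_abs, Real.abs_exp, Real.exp_le_one_iff, neg_nonpos]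
      exact mul_nonneg (le_of_lt hu) hx
    refine tendsto_nhds_unique h1 (h2.congr' ?_)
    filter_upwards [self_mem_nhdsWithin] with u hu using (hpos u hu).symm
  · exact hpos u hu
end

theorem theorem1p1 (φ : ℝ → ℝ) (hcont : ContinuousOn φ (Ici 0))
    (hsmooth : ContDiffOn ℝ ∞ φ (Ioi 0)) :
    (∀ t : ℝ, 0 < t → IsLogConcaveSeq (altTaylorCoeff φ t)) ↔
      ∃ μ : Measure ℝ, IsFiniteMeasure μ ∧ IsLogConcaveMeasureOnHalfLine μ ∧
        ∀ t : ℝ, 0 ≤ t → φ t = ∫ x in Ici (0 : ℝ), Real.exp (-(t * x)) ∂μ := by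
  refine ⟨exists_logConcaveMeasure hcont hsmooth, ?_⟩
  rintro ⟨μ, hfin, hμ, hφ⟩ t ht
  exact isLogConcaveSeq_altTaylorCoeff_of_laplace hμ hφ ht
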